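/- **Setting.** Let $\mathtt k$ be an algebraically closed field of characteristic $0$ and let $m\ge n\ge 1$ be integers. *Groupoid, actions, orbits.* Let $\Delta_{iso}=\{\pm(\epsilon_i-\delta_j)\mid 1\le i\le n,\ 1\le j\le m\}$, and let $\mathfrak T_{iso}$ be the groupoid with set of objects $\Delta_{iso}$ whose non-identity morphisms are $\rho_\alpha:\alpha\to-\alpha$ for $\alpha\in\Delta_{iso}$. For a set $V$, the groupoid $\mathfrak S(V)$ has the subsets of $V$ as objects and all bijections between them as morphisms. A functor $G:\mathfrak T_{iso}\to\mathfrak S(V)$ (an action on $V$) defines a directed labelled graph on $V$: there is an arrow $v\xrightarrow{\alpha}w$ iff $v\in G(\alpha)$ and $G(\rho_\alpha)(v)=w$. The connected component of $v$ in this graph is the orbit $\mathcal O(G,v)$. Let $\nu(\epsilon_i-\delta_j)=\epsilon_{i+1}-\delta_j$ for $i<n$, $\nu(\epsilon_n-\delta_j)=\epsilon_1-\delta_j$, and $\nu(-\alpha)=-\nu(\alpha)$. *Young diagrams.* Let $X$ be the set of partitions $\lambda=(m\ge\lambda_1\ge\dots\ge\lambda_n\ge0)$, drawn as Young diagrams in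 a rectangle with rows $\epsilon_1,\dots,\epsilon_n$ (top to bottom) and columns $\delta_1,\dots,\delta_m$ (left to right), with $\lambda_{n+1-i}$ left-justified boxes in row $\epsilon_i$. For $\alpha=\epsilon_i-\delta_j$ let $X_\alpha$ (resp. $X_{-\alpha}$) be the set of $\lambda\in X$ for which the box in row $\epsilon_i$, column $\delta_j$ is an outer (resp. inner) corner, that is, can be added to (resp. removed from) $\lambda$ to give a new diagram, and let $t_{\pm\alpha}:X_{\pm\alpha}\to X_{\mp\alpha}$ add/remove this box. Let $\sim$ be the smallest equivalence relation on $X\times\mathbb Z$ with $(\lambda,k)\sim((\lambda_2,\dots,\lambda_n,0),k+1)$ whenever $\lambda_1=m$, let $[\lambda,k]$ be the class of $(\lambda,k)$ and $[X\times\mathbb Z]$ the set of classes. The action $F$ of $\mathfrak T_{iso}$ on $[X\times\mathbb Z]$ is given by $$F(\alpha)=\bigcup_{k\in\mathbb Z}\{[\lambda,k]\mid\lambda\in X_{\nu^k\alpha}\},\qquad F(\rho_\alpha)[\lambda,k]=[t_{\nu^k\alpha}(\lambda),k]\quad(\lambda\in X_{\nu^k\alpha}).$$ *Borel subalgebras.*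 Let $\overset{\circ}{\mathfrak g}=\mathfrak{sl}(n|m)$ if $m>n$ and $\overset{\circ}{\mathfrak g}=\mathfrak{gl}(n|n)$ if $m=n$, with the form $(x,y)=\mathrm{str}(xy)$ and the subalgebra $\overset{\circ}{\mathfrak h}$ of diagonal matrices. Let $\widehat L$ be its affinization: $\mathtt k[t,t^{-1}]\otimes\overset{\circ}{\mathfrak g}\oplus\mathtt kc\oplus\mathtt kd$ if $m>n$, and its subalgebra $\mathfrak{gl}(n|n)\oplus\bigoplus_{p\ne0}t^p\mathfrak{sl}(n|n)\oplus\mathtt kc\oplus\mathtt kd$ if $m=n$, where $c$ is central, $d$ acts as $t\frac{d}{dt}$, and $[t^px,t^qy]=t^{p+q}[x,y]+p\,(x,y)\,\delta_{p,-q}\,c$. Put $\mathfrak h=\overset{\circ}{\mathfrak h}\oplus\mathtt kc\oplus\mathtt kd$, extend $\epsilon_i$ and $\delta_j$ by $0$ to $c$ and $d$, and let $\bar\delta\in\mathfrak h^*$ satisfy $\bar\delta(d)=1$, $\bar\delta(\overset{\circ}{\mathfrak h})=\bar\delta(c)=0$. The Borel subalgebra with set of simple roots $\Pi\subset\mathfrak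 h^*$ is the subalgebra generated by $\mathfrak h$ and the root spaces of all roots in the $\mathbb N$-span of $\Pi$. For $k\in\mathbb Z$ let $\overset{\circ}{\mathfrak g}(k)\cong\overset{\circ}{\mathfrak g}$ be the subalgebra of $\widehat L$ whose roots are the differences of distinct elements among $\epsilon_1^{(k)},\dots,\epsilon_n^{(k)},\delta_1,\dots,\delta_m$, where $\epsilon_i^{(0)}=\epsilon_i$, $\epsilon_{i+1}^{(k+1)}=\epsilon_i^{(k)}$ for $i<n$, and $\epsilon_1^{(k+1)}=\epsilon_n^{(k)}+\bar\delta$; so $\overset{\circ}{\mathfrak g}(0)=\overset{\circ}{\mathfrak g}$. For a shuffle $\sigma$ of the sequences $\epsilon_1^{(k)},\dots,\epsilon_n^{(k)}$ and $\delta_1,\dots,\delta_m$, written $\sigma=(\eta_1,\dots,\eta_{m+n})$, the Borel subalgebra $\overset{\circ}{\mathfrak b}(\sigma,k)$ of $\overset{\circ}{\mathfrak g}(k)$ has simple roots $\eta_i-\eta_{i+1}$ $(1\le i<m+n)$, and its extension to $\widehat L$ is the Borel subalgebra whose simple roots are these together with $\bar\delta-(\eta_1-\eta_{m+n})$. Let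 $\mathcal B$ be the set of all these extensions (over all $k$ and $\sigma$), and let $\mathfrak b\in\mathcal B$ be the extension of the distinguished Borel subalgebra of $\overset{\circ}{\mathfrak g}(0)$, which belongs to $\sigma=(\epsilon_1,\dots,\epsilon_n,\delta_1,\dots,\delta_m)$. The action $B$ of $\mathfrak T_{iso}$ on $\mathcal B$ is by odd reflections: $\mathfrak b_1\xrightarrow{\alpha}\mathfrak b_2$ iff for some $p\in\mathbb Z$ the root $\beta=\alpha+p\bar\delta$ is a root of $\mathfrak b_1$ and the roots of $\mathfrak b_2$ are those of $\mathfrak b_1$ with $\beta$ replaced by $-\beta$. *The Sergeev–Veselov action* (for $\kappa=-n/m$). Write $(a_1,\dots,a_n|b_1,\dots,b_m)=\sum a_i\epsilon_i-\sum b_j\delta_j\in\mathbb Z^{n|m}$, with the form $(\epsilon_i,\epsilon_j)=\delta_{i,j}=-(\delta_i,\delta_j)$, $(\epsilon_i,\delta_j)=0$. For $\alpha=\epsilon_i-\delta_j$, $SV(\alpha)=\{\Lambda\mid(\Lambda,\alpha)=0\}$, $SV(-\alpha)=\{\Lambda\mid(\Lambda,\alpha)=n-m\}$, and $SV(\rho_{\pm\alpha})(\Lambda)=\Lambda\pm(n\epsilon_i-m\delta_j)$.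 Let $\Lambda_0=(m(n-1),\dots,m,0\,|\,0,n,\dots,n(m-1))$. For $\lambda\in X$ let $x(\lambda)=(a|b)$ with $a_i=m(n-i)+n\lambda_{n+1-i}$ and $b_j=n(j-1)+m\,|\{i\mid\lambda_i\ge j\}|$, and put $x(\lambda,k)=\nu^{-k}x(\lambda)+k(m,\dots,m|m,\dots,m)$, where $\nu(a_1,\dots,a_n|b)=(a_n,a_1,\dots,a_{n-1}|b)$. This induces a map $x:[X\times\mathbb Z]\to\mathbb Z^{n|m}$. **Theorem 1.1.** The functors $F:\mathfrak T_{iso}\to\mathfrak S([X\times\mathbb Z])$ and $B:\mathfrak T_{iso}\to\mathfrak S(\mathcal B)$ above exist, and: (a) There is an isomorphism of directed labelled graphs $\mathcal O(F,[\emptyset,0])\to\mathcal O(B,\mathfrak b)$, with $[\emptyset,0]\mapsto\mathfrak b$. (b) If $m,n$ are coprime, then the map $x$ induces an isomorphism of directed labelled graphs $\mathcal O(F,[\emptyset,0])\to\mathcal O(SV,\Lambda_0)$, with $[\emptyset,0]\mapsto\Lambda_0$. -/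

import Mathlib

open CategoryTheory
open scoped LaurentPolynomial

/-! ## The groupoid of isotropic roots, symmetric groupoids, orbits -/

/-- The isotropic root `sign • (ε_row - δ_col)` of `gl(n|m)`. Rows and columns are counted from `0`,
so that `ε_i` and `δ_j` in the usual notation have index `i - 1` and `j - 1` here. -/
@[ext] structure IsoRoot (n m : ℕ) where
  sign : ℤˣ
  row : Fin n
  col : Fin m

namespace IsoRoot

variable {n m : ℕ}

instance : Neg (IsoRoot n m) := ⟨fun α => ⟨-α.sign, α.row, α.col⟩⟩

@[simp] theorem neg_sign (α : IsoRoot n m) : (-α).sign = -α.sign := rfl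
@[simp] theorem neg_row (α : IsoRoot n m) : (-α).row = α.row := rfl
@[simp] theorem neg_col (α : IsoRoot n m) : (-α).col = α.col := rfl

theorem neg_neg' (α : IsoRoot n m) : - -α = α := by ext <;> simp

/-- The groupoid `𝔗_iso`. Its objects are the isotropic roots, and its non-identity morphisms are
`ρ_α : α ⟶ -α`, one for each isotropic root `α` (so `ρ_{-α}` is the inverse of `ρ_α`). -/
instance : Groupoid (IsoRoot n m) where
  Hom α β := PLift (β = α ∨ β = -α)
  id _ := ⟨Or.inl rfl⟩
  comp f g := ⟨by
    rcases f.down with rfl | rfl <;> rcases g.down with rfl | rfl <;> simp [neg_neg']⟩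
  inv f := ⟨by rcases f.down with rfl | rfl <;> simp [neg_neg']⟩

/-- The morphism `ρ_α : α ⟶ -α`. -/
def rho (α : IsoRoot n m) : α ⟶ -α := PLift.up (Or.inr rfl)

/-- `ν^k` on isotropic roots, where `ν (ε_i - δ_j) = ε_{i+1} - δ_j` for `i < n` and
`ν (ε_n - δ_j) = ε_1 - δ_j`. -/
def rotate (k : ℤ) (α : IsoRoot n m) : IsoRoot n m := ⟨α.sign, (finRotate n ^ k) α.row, α.col⟩

end IsoRoot

/-- The objects of the symmetric groupoid `𝔖(V)`: all subsets of `V`. -/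
structure SymGroupoid (V : Type*) where
  carrier : Set V

/-- The morphisms of `𝔖(V)` from `U` to `W` are all bijections from `U` to `W`. -/
instance (V : Type*) : Groupoid (SymGroupoid V) where
  Hom U W := U.carrier ≃ W.carrier
  id U := Equiv.refl U.carrier
  comp f g := Equiv.trans f g
  inv f := Equiv.symm f

/-- A morphism of `𝔖(V)` as a map. -/
def SymGroupoid.toMap {V : Type*} {U W : SymGroupoid V} (f : U ⟶ W) : U.carrier → W.carrier :=
  Equiv.toFun f

section Actions

variable {n m : ℕ} {V V' : Type*}

/-- The labelled arrow `v --α--> w` of an action `G` of `𝔗_iso` on `V`: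
`v ∈ G(α)` and `G(ρ_α)(v) = w`. -/
def HasArrow (G : IsoRoot n m ⥤ SymGroupoid V) (α : IsoRoot n m) (v w : V) : Prop :=
  ∃ h : v ∈ (G.obj α).carrier, (SymGroupoid.toMap (G.map α.rho) ⟨v, h⟩ : V) = w

/-- The orbit of `v`: the connected component of `v` in the graph of the action. -/
def orbit (G : IsoRoot n m ⥤ SymGroupoid V) (v : V) : Set V :=
  {w | Relation.EqvGen (fun a b => ∃ α, HasArrow G α a b) v w}

theorem mem_orbit_self (G : IsoRoot n m ⥤ SymGroupoid V) (v : V) : v ∈ orbit G v :=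
  Relation.EqvGen.refl v

/-- An isomorphism of directed labelled graphs between two orbits. -/
structure OrbitIso (G : IsoRoot n m ⥤ SymGroupoid V) (v : V)
    (G' : IsoRoot n m ⥤ SymGroupoid V') (v' : V') where
  toEquiv : orbit G v ≃ orbit G' v'
  arrow_iff : ∀ (α : IsoRoot n m) (a b : orbit G v),
    HasArrow G α a b ↔ HasArrow G' α (toEquiv a) (toEquiv b)

/-- The action `G` has exactly the labelled arrows prescribed by `R`. (This determines `G`: `G(α)`
is the set of sources of arrows labelled `α`, and `G(ρ_α)` sends a source to its target.) -/
def HasArrows (G : IsoRoot n m ⥤ SymGroupoid V) (R : IsoRoot n m → V → V → Prop) : Prop :=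
  ∀ α v w, HasArrow G α v w ↔ R α v w

end Actions

/-! ## Young diagrams in the rectangle and the extended action -/

/-- A partition `m ≥ λ_1 ≥ ⋯ ≥ λ_n ≥ 0`; here `part i` is `λ_{i+1}`. -/
@[ext] structure Diagram (n m : ℕ) where
  part : Fin n → ℕ
  anti : Antitone part
  le : ∀ i, part i ≤ m

namespace Diagram

variable {n m : ℕ}

/-- The boxes of the Young diagram of `λ`, as positions (row, column) in the rectangle with `n` rows,
counted from the top, and `m` columns, counted from the left. The row of `ε_i` contains the first
`λ_{n+1-i}` boxes. -/
def boxes (l : Diagram n m) : Set (Fin n × Fin m) := {b | b.2.val < l.part b.1.rev}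

/-- `μ` is obtained from `λ` by adding the box `b`; such a `μ` exists iff `b` is an outer corner
of `λ`, and such a `λ` exists iff `b` is an inner corner of `μ`. -/
def AddBox (b : Fin n × Fin m) (l u : Diagram n m) : Prop :=
  b ∉ l.boxes ∧ u.boxes = insert b l.boxes

/-- The graph of the bijection `t_α : X_α → X_{-α}`: for `α = ε_i - δ_j` add, and for
`α = -(ε_i - δ_j)` delete, the box in row `ε_i` and column `δ_j`. -/
def BoxMove (α : IsoRoot n m) (l u : Diagram n m) : Prop :=
  (α.sign = 1 ∧ AddBox (α.row, α.col) l u) ∨ (α.sign = -1 ∧ AddBox (α.row, α.col) u l)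

/-- The empty diagram. -/
def empty (n m : ℕ) : Diagram n m := ⟨fun _ => 0, fun _ _ _ => le_rfl, fun _ => Nat.zero_le _⟩

/-- `(λ_2, …, λ_n, 0)`. -/
def dropFirst (l : Diagram n m) : Diagram n m where
  part i := if h : i.val + 1 < n then l.part ⟨i.val + 1, h⟩ else 0
  anti i j hij := by
    have hij' : i.val ≤ j.val := hij
    dsimp only
    split_ifs with h1 h2
    · exact l.anti (Fin.mk_le_mk.2 (Nat.succ_le_succ hij'))
    · omega
    · exact Nat.zero_le _
    · exact le_rfl
  le i := by
    split_ifs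
    · exact l.le _
    · exact Nat.zero_le _

/-- The conjugate partition: `conj j` is `λ'_{j+1} = #{i | λ_i ≥ j + 1}`. -/
def conj (l : Diagram n m) (j : Fin m) : ℕ := (Finset.univ.filter fun i => j.val < l.part i).card

end Diagram

section Young

variable (n m : ℕ) [NeZero n]

/-- The relation `(λ, k) ∼ (λ̄, k + 1)` if `λ_1 = m`. -/
inductive RowDeletion : Diagram n m × ℤ → Diagram n m × ℤ → Prop
  | mk (l : Diagram n m) (k : ℤ) (h : l.part 0 = m) : RowDeletion (l, k) (l.dropFirst, k + 1)

/-- `[X × ℤ]`: the quotient of `X × ℤ` by the smallest equivalence relation containing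
`RowDeletion`. -/
def YoungClass : Type := Quot (RowDeletion n m)

variable {n m}

/-- The class `[λ, k]`. -/
def YoungClass.mk (l : Diagram n m) (k : ℤ) : YoungClass n m := Quot.mk _ (l, k)

/-- The arrows of the extended action `F` of `𝔗_iso` on `[X × ℤ]`: `F(α)` is the union of the
`[X_{ν^k α}, k]`, and `F(ρ_α)[λ, k] = [t_{ν^k α}(λ), k]` for `λ ∈ X_{ν^k α}`. -/
def YoungArrow (α : IsoRoot n m) (v w : YoungClass n m) : Prop :=
  ∃ (k : ℤ) (l u : Diagram n m), Diagram.BoxMove (α.rotate k) l u ∧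
    v = YoungClass.mk l k ∧ w = YoungClass.mk u k

end Young

/-! ## The Sergeev-Veselov action -/

/-- `ℤ^{n|m}`; the pair `(a, b)` is `(a_1, …, a_n | b_1, …, b_m) = ∑ a_i ε_i - ∑ b_j δ_j`. -/
abbrev SuperLattice (n m : ℕ) : Type := (Fin n → ℤ) × (Fin m → ℤ)

namespace SuperLattice

variable {n m : ℕ}

/-- The bilinear form with `(ε_i, ε_i) = 1 = -(δ_j, δ_j)` and all other products of basis vectors
equal to `0`. -/
def form (x y : SuperLattice n m) : ℤ := ∑ i, x.1 i * y.1 i - ∑ j, x.2 j * y.2 j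

/-- `c ε_i - d δ_j`. -/
def vec (c d : ℤ) (i : Fin n) (j : Fin m) : SuperLattice n m := (Pi.single i c, Pi.single j d)

/-- For `α = ε_i - δ_j`, the hyperplanes `Π_α = {Λ | (Λ, α) = 0}` and
`Π_{-α} = {Λ | (Λ, α) = n - m}`. -/
def hyperplane (α : IsoRoot n m) : Set (SuperLattice n m) :=
  {x | form x (vec 1 1 α.row α.col) = if α.sign = 1 then 0 else (n : ℤ) - m}

theorem form_add_vec (x : SuperLattice n m) (s c d : ℤ) (i : Fin n) (j : Fin m) :
    form (x + s • vec c d i j) (vec 1 1 i j) = form x (vec 1 1 i j) + s * (c - d) := by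
  simp [form, vec, Pi.single_apply]
  ring

/-- The multiple of `v = n ε_i - m δ_j` that the morphism from `α` to `β = ±α` adds. -/
def shift (α β : IsoRoot n m) : ℤ := if β.sign = α.sign then 0 else α.sign

theorem shift_self (α : IsoRoot n m) : shift α α = 0 := by simp [shift]

theorem shift_neg (α : IsoRoot n m) : shift α (-α) = α.sign := by
  rcases Int.units_eq_one_or α.sign with h | h <;> simp [shift, h]

theorem shift_comp {α β γ : IsoRoot n m} (f : α ⟶ β) (g : β ⟶ γ) :
    shift α β + shift β γ = shift α γ := by
  rcases f.down with rfl | rfl <;> rcases g.down with rfl | rfl <;>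
    simp [shift_self, shift_neg, IsoRoot.neg_neg']
  have h := shift_neg (-α)
  rw [IsoRoot.neg_neg'] at h
  rw [h]
  simp

theorem add_shift_mem {α β : IsoRoot n m} (f : α ⟶ β) {x : SuperLattice n m}
    (hx : x ∈ hyperplane α) :
    x + shift α β • vec (n : ℤ) m α.row α.col ∈ hyperplane β := by
  rcases f.down with rfl | rfl
  · simpa [shift_self] using hx
  · have hx' : form x (vec 1 1 α.row α.col) = if α.sign = 1 then 0 else (n : ℤ) - m := hx
    change form _ _ = _
    simp only [IsoRoot.neg_row, IsoRoot.neg_col, form_add_vec, hx', shift_neg, IsoRoot.neg_sign]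
    rcases Int.units_eq_one_or α.sign with h' | h' <;> simp [h']

theorem row_eq {α β : IsoRoot n m} (f : α ⟶ β) : β.row = α.row ∧ β.col = α.col := by
  rcases f.down with rfl | rfl <;> simp

end SuperLattice

open SuperLattice in
/-- The Sergeev-Veselov functor for `κ = -n/m`: `SV(±α) = Π_{±α}`, and `SV(ρ_{±α})` is
`Λ ↦ Λ ± (n ε_i - m δ_j)`, where `α = ε_i - δ_j`. -/
def SV (n m : ℕ) : IsoRoot n m ⥤ SymGroupoid (SuperLattice n m) where
  obj α := ⟨hyperplane α⟩
  map {α β} f :=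
    { toFun := fun x => ⟨x.1 + shift α β • vec (n : ℤ) m α.row α.col, add_shift_mem f x.2⟩
      invFun := fun x =>
        ⟨x.1 + shift β α • vec (n : ℤ) m β.row β.col, add_shift_mem (Groupoid.inv f) x.2⟩
      left_inv := fun x => by
        apply Subtype.ext
        have h := shift_comp f (Groupoid.inv f)
        rw [shift_self] at h
        simp only [(row_eq f).1, (row_eq f).2, add_assoc, ← add_smul, h, zero_smul, add_zero]
      right_inv := fun x => by
        apply Subtype.ext
        have h := shift_comp (Groupoid.inv f) f
        rw [shift_self] at h
        simp only [(row_eq f).1, (row_eq f).2, add_assoc, ← add_smul, h, zero_smul, add_zero] }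
  map_id α := by
    apply Equiv.ext
    intro x
    apply Subtype.ext
    change x.1 + shift α α • _ = x.1
    rw [shift_self, zero_smul, add_zero]
  map_comp {α β γ} f g := by
    apply Equiv.ext
    intro x
    apply Subtype.ext
    change x.1 + shift α γ • vec (n : ℤ) m α.row α.col =
      x.1 + shift α β • vec (n : ℤ) m α.row α.col + shift β γ • vec (n : ℤ) m β.row β.col
    rw [(row_eq f).1, (row_eq f).2, add_assoc, ← add_smul, shift_comp f g]

/-- `Λ_0 = (m(n-1), …, m, 0 | 0, n, …, n(m-1))`. -/
def lambdaZero (n m : ℕ) : SuperLattice n m :=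
  (fun i => (m : ℤ) * ((n : ℤ) - (i.val + 1)), fun j => (n : ℤ) * j.val)

/-- `x(λ) ∈ ℤ^{n|m}`, given by `a_i = m(n-i) + n λ_{n+1-i}` and `b_j = n(j-1) + m λ'_j`. -/
def xDiagram {n m : ℕ} (l : Diagram n m) : SuperLattice n m :=
  (fun i => (lambdaZero n m).1 i + n * l.part i.rev,
    fun j => (lambdaZero n m).2 j + m * l.conj j)

/-- `ν^k` on `ℤ^{n|m}`, where `ν(a_1, …, a_n | b) = (a_n, a_1, …, a_{n-1} | b)`. -/
def nuPow {n m : ℕ} (k : ℤ) (x : SuperLattice n m) : SuperLattice n m :=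
  (fun i => x.1 ((finRotate n ^ (-k)) i), x.2)

/-- `x(λ, k) = ν^{-k} x(λ) + k (m, …, m | m, …, m)`. -/
def xPair {n m : ℕ} (p : Diagram n m × ℤ) : SuperLattice n m :=
  nuPow (-p.2) (xDiagram p.1) + (fun _ => p.2 * (m : ℤ), fun _ => p.2 * (m : ℤ))

theorem xDiagram_dropFirst_fst {n m : ℕ} [NeZero n] (l : Diagram n m) (h : l.part 0 = m)
    (i : Fin n) :
    (xDiagram l.dropFirst).1 (finRotate n i) + m = (xDiagram l).1 i := by
  obtain ⟨N, rfl⟩ : ∃ N, n = N + 1 := ⟨n - 1, by have := NeZero.pos n; omega⟩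
  rcases Nat.lt_or_ge i.val N with hi | hi
  · have e : finRotate (N + 1) i = ⟨i.val + 1, by omega⟩ := finRotate_of_lt hi
    have e2 : l.dropFirst.part (Fin.rev ⟨i.val + 1, by omega⟩) = l.part i.rev := by
      have : (Fin.rev (⟨i.val + 1, by omega⟩ : Fin (N + 1))).val + 1 < N + 1 := by
        simp [Fin.val_rev]; omega
      simp only [Diagram.dropFirst, dif_pos this]
      congr 1
      ext
      simp [Fin.val_rev]; omega
    simp only [xDiagram, lambdaZero, e, e2]
    push_cast
    ring
  · have hi' : i = Fin.last N := Fin.ext (by simp; omega)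
    subst hi'
    have e2 : l.dropFirst.part (Fin.rev (0 : Fin (N + 1))) = 0 := by
      simp [Diagram.dropFirst]
    simp only [xDiagram, lambdaZero, finRotate_last, e2, Fin.rev_last, h]
    push_cast
    simp
    ring

theorem conj_dropFirst {n m : ℕ} [NeZero n] (l : Diagram n m) (h : l.part 0 = m) (j : Fin m) :
    l.dropFirst.conj j + 1 = l.conj j := by
  obtain ⟨N, rfl⟩ : ∃ N, n = N + 1 := ⟨n - 1, by have := NeZero.pos n; omega⟩
  have e1 : l.conj j = ∑ i : Fin (N + 1), if j.val < l.part i then 1 else 0 := by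
    rw [Diagram.conj, Finset.card_filter]
  have e2 : l.dropFirst.conj j =
      ∑ i : Fin (N + 1), if j.val < l.dropFirst.part i then 1 else 0 := by
    rw [Diagram.conj, Finset.card_filter]
  have h0 : (if j.val < l.part 0 then 1 else 0) = 1 := by rw [h, if_pos j.isLt]
  have hs : ∀ i : Fin N, l.dropFirst.part i.castSucc = l.part i.succ := fun i => by
    simp only [Diagram.dropFirst, Fin.val_castSucc]
    rw [dif_pos (by omega)]
    rfl
  have hl : l.dropFirst.part (Fin.last N) = 0 := by simp [Diagram.dropFirst]
  rw [e1, e2, Fin.sum_univ_castSucc,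
    Fin.sum_univ_succ (fun i : Fin (N + 1) => if j.val < l.part i then 1 else 0), h0, hl]
  simp only [hs]
  simp [add_comm]

/-- The map `x : [X × ℤ] → ℤ^{n|m}` induced by `(λ, k) ↦ x(λ, k)`. -/
def xMap (n m : ℕ) [NeZero n] : YoungClass n m → SuperLattice n m :=
  Quot.lift xPair (by
    rintro _ _ ⟨l, k, h⟩
    apply Prod.ext
    · funext i
      have := xDiagram_dropFirst_fst l h ((finRotate n ^ k) i)
      have e : (finRotate n ^ (k + 1)) i = finRotate n ((finRotate n ^ k) i) := by
        rw [add_comm, zpow_add, zpow_one, Equiv.Perm.mul_apply]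
      simp only [xPair, nuPow, neg_neg, Prod.fst_add, Pi.add_apply, e, ← this]
      ring
    · funext j
      have := conj_dropFirst l h j
      simp only [xPair, nuPow, xDiagram, Prod.snd_add, Pi.add_apply, ← this]
      push_cast
      ring)

/-! ## The affine Lie superalgebra -/

/-- Indices of the rows and columns of `(n|m)`-matrices: `inl i` is even, `inr j` is odd. -/
abbrev Idx (n m : ℕ) : Type := Fin n ⊕ Fin m

noncomputable section Affine

variable (k : Type*) [Field k] (n m : ℕ)

/-- Elements `x + a c + b d` of the affinization of `gl(n|m)`, written `(x, a, b)`, with `x` in the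
loop algebra `k[t, t⁻¹] ⊗ gl(n|m)`. -/
abbrev AffineGL : Type _ := Matrix (Idx n m) (Idx n m) k[T;T⁻¹] × k × k

variable {k n m}

/-- The derivation `t d/dt` of `k[t, t⁻¹]`. -/
def euler (f : k[T;T⁻¹]) : k[T;T⁻¹] :=
  f.coeff.sum fun p c => LaurentPolynomial.C ((p : k) * c) * LaurentPolynomial.T p

/-- The even part of a matrix. -/
def evenPart {A : Type*} [Zero A] (x : Matrix (Idx n m) (Idx n m) A) :
    Matrix (Idx n m) (Idx n m) A :=
  Matrix.of fun a b => if a.isLeft = b.isLeft then x a b else 0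

/-- The odd part of a matrix. -/
def oddPart {A : Type*} [Zero A] (x : Matrix (Idx n m) (Idx n m) A) :
    Matrix (Idx n m) (Idx n m) A :=
  Matrix.of fun a b => if a.isLeft = b.isLeft then 0 else x a b

/-- The supercommutator: `x y - y x` if `x` or `y` is even, and `x y + y x` if both are odd. -/
def superComm {A : Type*} [CommRing A] (x y : Matrix (Idx n m) (Idx n m) A) :
    Matrix (Idx n m) (Idx n m) A :=
  x * y - (evenPart y * evenPart x + evenPart y * oddPart x + oddPart y * evenPart x
    - oddPart y * oddPart x)

/-- The supertrace. -/
def superTrace {A : Type*} [CommRing A] (x : Matrix (Idx n m) (Idx n m) A) : A :=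
  ∑ i, x (Sum.inl i) (Sum.inl i) - ∑ j, x (Sum.inr j) (Sum.inr j)

/-- The bracket of the affinization: `c` is central, `d` acts on the loop algebra as `t d/dt`, and
`[t^p x, t^q y] = t^{p+q} [x, y] + p (x, y) δ_{p,-q} c`, where `(x, y) = str (x y)`. -/
def affBracket (x y : AffineGL k n m) : AffineGL k n m :=
  (superComm x.1 y.1 + x.2.2 • y.1.map euler - y.2.2 • x.1.map euler,
    (superTrace (x.1.map euler * y.1)).coeff 0, 0)

theorem euler_add (f g : k[T;T⁻¹]) : euler (f + g) = euler f + euler g := by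
  unfold euler
  rw [AddMonoidAlgebra.coeff_add, Finsupp.sum_add_index'] <;> intros <;> simp [mul_add, add_mul]

theorem euler_smul (c : k) (f : k[T;T⁻¹]) : euler (c • f) = c • euler f := by
  unfold euler
  rw [AddMonoidAlgebra.coeff_smul, Finsupp.sum_smul_index' (by simp), Finsupp.smul_sum]
  refine Finsupp.sum_congr fun p _ => ?_
  simp only [LaurentPolynomial.smul_eq_C_mul, smul_eq_mul, map_mul]
  ring


theorem evenPart_add (x y : Matrix (Idx n m) (Idx n m) k[T;T⁻¹]) :
    evenPart (x + y) = evenPart x + evenPart y := by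
  ext1 a b; simp only [evenPart, Matrix.of_apply, Matrix.add_apply]; split_ifs <;> simp

theorem oddPart_add (x y : Matrix (Idx n m) (Idx n m) k[T;T⁻¹]) :
    oddPart (x + y) = oddPart x + oddPart y := by
  ext1 a b; simp only [oddPart, Matrix.of_apply, Matrix.add_apply]; split_ifs <;> simp

theorem evenPart_smul (c : k) (x : Matrix (Idx n m) (Idx n m) k[T;T⁻¹]) :
    evenPart (c • x) = c • evenPart x := by
  ext1 a b; simp only [evenPart, Matrix.of_apply, Matrix.smul_apply]; split_ifs <;> simp

theorem oddPart_smul (c : k) (x : Matrix (Idx n m) (Idx n m) k[T;T⁻¹]) :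
    oddPart (c • x) = c • oddPart x := by
  ext1 a b; simp only [oddPart, Matrix.of_apply, Matrix.smul_apply]; split_ifs <;> simp

theorem superComm_add (x y z : Matrix (Idx n m) (Idx n m) k[T;T⁻¹]) :
    superComm x (y + z) = superComm x y + superComm x z := by
  simp only [superComm, evenPart_add, oddPart_add, mul_add, add_mul]
  abel

theorem superComm_smul (c : k) (x y : Matrix (Idx n m) (Idx n m) k[T;T⁻¹]) :
    superComm x (c • y) = c • superComm x y := by
  simp only [superComm, evenPart_smul, oddPart_smul, Matrix.mul_smul, Matrix.smul_mul, smul_sub,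
    smul_add]

theorem superTrace_add (x y : Matrix (Idx n m) (Idx n m) k[T;T⁻¹]) :
    superTrace (x + y) = superTrace x + superTrace y := by
  simp only [superTrace, Matrix.add_apply, Finset.sum_add_distrib]
  abel

theorem superTrace_smul (c : k) (x : Matrix (Idx n m) (Idx n m) k[T;T⁻¹]) :
    superTrace (c • x) = c • superTrace x := by
  simp only [superTrace, Matrix.smul_apply, ← Finset.smul_sum, smul_sub]

theorem affBracket_add (x y z : AffineGL k n m) :
    affBracket x (y + z) = affBracket x y + affBracket x z := by
  have he : (y.1 + z.1).map euler = y.1.map euler + z.1.map euler := by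
    ext1 a b; exact euler_add _ _
  refine Prod.ext ?_ (Prod.ext ?_ ?_)
  · simp only [affBracket, Prod.fst_add, Prod.snd_add, superComm_add, he, smul_add, add_smul]
    abel
  · simp only [affBracket, Prod.fst_add, Prod.snd_add, mul_add, superTrace_add,
      AddMonoidAlgebra.coeff_add, Finsupp.add_apply]
  · simp [affBracket]

theorem affBracket_smul (c : k) (x y : AffineGL k n m) :
    affBracket x (c • y) = c • affBracket x y := by
  have he : (c • y.1).map euler = c • y.1.map euler := by
    ext1 a b; exact euler_smul _ _
  refine Prod.ext ?_ (Prod.ext ?_ ?_)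
  · simp only [affBracket, Prod.smul_fst, Prod.smul_snd, superComm_smul, he, smul_sub, smul_add,
      smul_comm x.2.2 c, smul_assoc]
  · simp only [affBracket, Prod.smul_fst, Prod.smul_snd, Matrix.mul_smul, superTrace_smul,
      AddMonoidAlgebra.coeff_smul, Finsupp.smul_apply]
  · simp [affBracket]

theorem affBracket_zero (x : AffineGL k n m) : affBracket x 0 = 0 := by
  have h := affBracket_add x 0 0
  rwa [add_zero, left_eq_add] at h

variable (k n m)

/-- The affinization of `sl(n|m)` if `n ≠ m`, and of `gl(n|n)` if `n = m`: the elements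
`∑ t^p x_p + a c + b d` such that `x_p ∈ sl(n|m)`, where for `n = m` and `p = 0` arbitrary
`x_0 ∈ gl(n|n)` are allowed. -/
def affinization : Submodule k (AffineGL k n m) where
  carrier := {x | ∀ p : ℤ, n ≠ m ∨ p ≠ 0 → (superTrace x.1).coeff p = 0}
  add_mem' := by
    intro x y hx hy p hp
    rw [Prod.fst_add, superTrace_add, AddMonoidAlgebra.coeff_add, Finsupp.add_apply, hx p hp,
      hy p hp, add_zero]
  zero_mem' := by
    intro p _
    simp [superTrace]
  smul_mem' := by
    intro c x hx p hp
    rw [Prod.smul_fst, superTrace_smul, AddMonoidAlgebra.coeff_smul, Finsupp.smul_apply, hx p hp,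
      smul_zero]

/-- The Cartan subalgebra `𝔥 = 𝔥° ⊕ k c ⊕ k d` of the affinization, where `𝔥°` consists of the
diagonal matrices with entries in `k`. -/
def cartan : Submodule k (AffineGL k n m) where
  carrier := {x | x ∈ affinization k n m ∧ (∀ a b, a ≠ b → x.1 a b = 0) ∧
    ∀ a, ∀ p : ℤ, p ≠ 0 → (x.1 a a).coeff p = 0}
  add_mem' := by
    rintro x y ⟨hx, hx', hx''⟩ ⟨hy, hy', hy''⟩
    refine ⟨add_mem hx hy, fun a b h => ?_, fun a p h => ?_⟩
    · simp [hx' a b h, hy' a b h]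
    · simp [hx'' a p h, hy'' a p h]
  zero_mem' := ⟨zero_mem _, fun _ _ _ => rfl, fun _ _ _ => rfl⟩
  smul_mem' := by
    rintro c x ⟨hx, hx', hx''⟩
    refine ⟨Submodule.smul_mem _ c hx, fun a b h => ?_, fun a p h => ?_⟩
    · simp [hx' a b h]
    · simp [hx'' a p h]

variable {k n m}

/-- The weight `ε_a ∈ 𝔥*` (so `ε_{inr j}` is `δ_j`), extended by zero to `c` and `d`. -/
def eps (a : Idx n m) : Module.Dual k (cartan k n m) where
  toFun h := (h.1.1 a a).coeff 0
  map_add' _ _ := rfl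
  map_smul' _ _ := rfl

variable (k n m) in
/-- The weight `δ̄ ∈ 𝔥*`: `δ̄(d) = 1`, and `δ̄` vanishes on `𝔥°` and `c`. -/
def deltaBar : Module.Dual k (cartan k n m) where
  toFun h := h.1.2.2
  map_add' _ _ := rfl
  map_smul' _ _ := rfl

/-- The weight space `{x | [h, x] = γ(h) x for all h ∈ 𝔥}` of the affinization. -/
def rootSpace (γ : Module.Dual k (cartan k n m)) : Submodule k (AffineGL k n m) where
  carrier := {x | x ∈ affinization k n m ∧ ∀ h : cartan k n m, affBracket h.1 x = γ h • x}
  add_mem' := by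
    rintro x y ⟨hx, hx'⟩ ⟨hy, hy'⟩
    exact ⟨add_mem hx hy, fun h => by rw [affBracket_add, hx', hy', smul_add]⟩
  zero_mem' := by
    exact ⟨zero_mem _, fun h => (affBracket_zero h.1).trans (smul_zero (γ h)).symm⟩
  smul_mem' := by
    rintro c x ⟨hx, hx'⟩
    exact ⟨Submodule.smul_mem _ c hx, fun h =>
      (affBracket_smul c h.1 x).trans ((congrArg (c • ·) (hx' h)).trans (smul_comm c (γ h) x))⟩

/-- The smallest subspace that contains `S` and is closed under the bracket. -/
def subalgebraSpan (S : Set (AffineGL k n m)) : Submodule k (AffineGL k n m) :=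
  sInf {W | S ⊆ W ∧ ∀ x ∈ W, ∀ y ∈ W, affBracket x y ∈ W}

/-- The Borel subalgebra with the set `S` of simple roots: the subalgebra generated by `𝔥` and the
root spaces of the positive roots, that is, of the roots in the `ℕ`-span of `S`. -/
def borelOf (S : Set (Module.Dual k (cartan k n m))) : Submodule k (AffineGL k n m) :=
  subalgebraSpan
    ((cartan k n m : Set (AffineGL k n m)) ∪ ⋃ β ∈ AddSubmonoid.closure S, rootSpace β)

end Affine

/-! ## Shuffles and the Borel subalgebras extended from `𝔤°(k)` -/

/-- A shuffle in one-line notation: a sequence in which every index occurs exactly once, and both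
`1, …, n` and `1', …, m'` are subsequences. -/
structure Shuffle (n m : ℕ) where
  toEquiv : Fin (n + m) ≃ Idx n m
  left_mono : StrictMono fun i : Fin n => toEquiv.symm (Sum.inl i)
  right_mono : StrictMono fun j : Fin m => toEquiv.symm (Sum.inr j)

/-- The identity shuffle `(1, …, n, 1', …, m')`, which gives the distinguished Borel subalgebra. -/
def Shuffle.one (n m : ℕ) : Shuffle n m where
  toEquiv := finSumFinEquiv.symm
  left_mono i j h := by
    change Fin.castAdd m i < Fin.castAdd m j
    rw [Fin.lt_def] at h ⊢
    exact h
  right_mono i j h := by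
    change Fin.natAdd n i < Fin.natAdd n j
    rw [Fin.lt_def] at h ⊢
    exact Nat.add_lt_add_left h n

noncomputable section Borels

variable (k : Type*) [Field k] {n m : ℕ}

/-- The weights `ε_1, …, ε_n, δ_1, …, δ_m` for the subalgebra `𝔤°(r)` of the affinization
(isomorphic to `𝔤°`), as weights of `𝔥`; the roots of `𝔤°(r)` are their differences. For `r = 0`
they are the usual ones. In passing from `𝔤°(r)` to `𝔤°(r + 1)` the weights `δ_j` do not change,
`ε_{i+1}` of `𝔤°(r + 1)` is `ε_i` of `𝔤°(r)` for `i < n`, and `ε_1` of `𝔤°(r + 1)` is `ε_n + δ̄`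
with `ε_n` of `𝔤°(r)`. -/
def localEps (r : ℤ) : Idx n m → Module.Dual k (cartan k n m)
  | Sum.inl i => eps (Sum.inl ((finRotate n ^ (-r)) i)) - ((i.val - r) / (n : ℤ)) • deltaBar k n m
  | Sum.inr j => eps (Sum.inr j)

/-- The simple roots `ε_{σ(i)} - ε_{σ(i+1)}` of the Borel subalgebra `𝔟°(σ, r)` of `𝔤°(r)`. -/
def simpleRoot (σ : Shuffle n m) (r : ℤ) (i : Fin (n + m - 1)) : Module.Dual k (cartan k n m) :=
  localEps k r (σ.toEquiv ⟨i.val, by omega⟩) - localEps k r (σ.toEquiv ⟨i.val + 1, by omega⟩)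

/-- The extending root `δ̄ - θ`, where `θ` is the sum of the simple roots. -/
def extendingRoot (σ : Shuffle n m) (r : ℤ) : Module.Dual k (cartan k n m) :=
  deltaBar k n m - ∑ i, simpleRoot k σ r i

/-- The extension to the affinization of the Borel subalgebra `𝔟°(σ, r)` of `𝔤°(r)`. -/
def extendedBorel (σ : Shuffle n m) (r : ℤ) : Submodule k (AffineGL k n m) :=
  borelOf (insert (extendingRoot k σ r) (Set.range (simpleRoot k σ r)))

variable (n m) in
/-- The set `𝓑` of Borel subalgebras of the affinization that are extended from Borel subalgebras of
the subalgebras `𝔤°(r)`, `r ∈ ℤ`. -/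
def AffineBorel : Type _ :=
  {b : Submodule k (AffineGL k n m) // ∃ (σ : Shuffle n m) (r : ℤ), b = extendedBorel k σ r}

variable (n m) in
/-- The Borel subalgebra extended from the distinguished Borel subalgebra of `𝔤°(0)`. -/
def distinguishedBorel : AffineBorel k n m :=
  ⟨extendedBorel k (Shuffle.one n m) 0, Shuffle.one n m, 0, rfl⟩

variable {k}

/-- `b'` is obtained from `b` by the reflection in the root `β`: `β` is a root of `b`, and the roots
of `b'` are those of `b`, except that `β` is replaced by `-β`. -/
def IsReflection (β : Module.Dual k (cartan k n m)) (b b' : Submodule k (AffineGL k n m)) : Prop :=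
  rootSpace β ≤ b ∧
    ∀ γ : Module.Dual k (cartan k n m), rootSpace γ ≤ b' ↔ γ = -β ∨ (γ ≠ β ∧ rootSpace γ ≤ b)

/-- The arrows of the action `B` of `𝔗_iso` on `𝓑` by odd reflections: `ρ_α` acts by the
reflection in an odd root of the affinization whose finite part is `α`. -/
def BorelArrow (α : IsoRoot n m) (b b' : AffineBorel k n m) : Prop :=
  ∃ p : ℤ, IsReflection ((α.sign : ℤ) • (eps (Sum.inl α.row) - eps (Sum.inr α.col))
    + p • deltaBar k n m) b.1 b'.1

end Borels

/-! ## Actions of the groupoid of isotropic roots -/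

section ActionLemmas

variable {n m : ℕ} {V V' : Type*}

/-! All three actions are compared through integer coordinates; indices count from `0` and `N = n +
m`.

Borel side. An extended Borel subalgebra is a periodic ordering of weights `η_x`, `x ∈ ℤ`, with
`η_{x+N} = η_x - δ̄` and simple roots `η_x - η_{x+1}`. If `f` records the positions of the weights
`ε_a`, then `ε_a - ε_b + p δ̄` has height `f b - f a + p N`, and the Borel subalgebra consists of
everything supported in nonnegative height (`extendedBorel_eq_heightBorel`). It determines `f` up to
an additive constant (`IsAffineOrder.sub_eq_sub`). A reflection is possible only in a root of height
one (`IsHeightReflection.height_eq_one`), and exchanging two neighbouring positions is such a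
reflection (`isHeightReflection_of_swap`).

Young side. The class `[λ, k]` is a periodically continued diagram, with row levels `row i` and
column levels `col j` that are unaffected by deleting a full row. The column levels determine the
class (`YoungClass.col_injective`), and adding a box raises one row level and one column level by
one. The box `(i, j)` can be added iff `row i - j = m Q` and `col j - (n - 1 - i) = n Q` for one and
the same `Q`; for removal both left sides are lowered by one (`YoungClass.IsCorner`).

For (a), the positions `i + row i` and `n + j - col j` form a height function. Height one is only
the sum of the two corner equations, but a box lies in a diagram by its row iff it does by its
column, and this separates them (`YoungClass.isCorner_of_adjacent`). The lost additive constant is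
recovered from `∑ row = ∑ col`.

For (b), `a_i - b_j = n (row i - j) - m (col j - (n - 1 - i))`. If this vanishes, coprimality
produces the common `Q` (`YoungClass.isCorner_of_coprime`).

Both maps are thus injective, preserve arrows and lift arrows, which suffices by `exists_orbitIso`.
-/

theorem IsoRoot.neg_ne_self (α : IsoRoot n m) : -α ≠ α := fun h => by
  have := congrArg IsoRoot.sign h
  rcases Int.units_eq_one_or α.sign with h' | h' <;> simp [h'] at this

/-- The relations `R α v w` which are the arrows `v --α--> w` of an action. -/
structure IsActionRel (R : IsoRoot n m → V → V → Prop) : Prop where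
  unique : ∀ {α v w w'}, R α v w → R α v w' → w = w'
  symm : ∀ {α v w}, R α v w → R (-α) w v

/-- The relation between the arguments and the values of the image of the morphism `α ⟶ β`. -/
def ActionStep (R : IsoRoot n m → V → V → Prop) (α β : IsoRoot n m) (v w : V) : Prop :=
  (β = α ∧ w = v) ∨ (β = -α ∧ R α v w)

namespace IsActionRel

variable {R : IsoRoot n m → V → V → Prop} (hR : IsActionRel R)

include hR

theorem step_unique {α β : IsoRoot n m} {v w w' : V} (h : ActionStep R α β v w)
    (h' : ActionStep R α β v w') : w = w' := by
  rcases h with ⟨rfl, rfl⟩ | ⟨rfl, h⟩ <;> rcases h' with ⟨e, h'⟩ | ⟨e, h'⟩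
  · exact h'.symm
  · exact absurd e.symm (IsoRoot.neg_ne_self _)
  · exact absurd e (IsoRoot.neg_ne_self _)
  · exact hR.unique h h'

theorem step_symm {α β : IsoRoot n m} {v w : V} (h : ActionStep R α β v w) :
    ActionStep R β α w v := by
  rcases h with ⟨rfl, rfl⟩ | ⟨rfl, h⟩
  · exact Or.inl ⟨rfl, rfl⟩
  · exact Or.inr ⟨(IsoRoot.neg_neg' α).symm, hR.symm h⟩

theorem step_trans {α β γ : IsoRoot n m} {u v w : V} (h : ActionStep R α β u v)
    (h' : ActionStep R β γ v w) : ActionStep R α γ u w := by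
  rcases h with ⟨rfl, rfl⟩ | ⟨rfl, h⟩
  · exact h'
  rcases h' with ⟨rfl, rfl⟩ | ⟨rfl, h'⟩
  · exact Or.inr ⟨rfl, h⟩
  · exact Or.inl ⟨IsoRoot.neg_neg' α, hR.unique h' (hR.symm h)⟩

theorem exists_step {α β : IsoRoot n m} (f : α ⟶ β) {v : V} (hv : ∃ w, R α v w) :
    ∃ w, ActionStep R α β v w ∧ ∃ u, R β w u := by
  rcases f.down with rfl | rfl
  · exact ⟨v, Or.inl ⟨rfl, rfl⟩, hv⟩
  · obtain ⟨w, hw⟩ := hv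
    exact ⟨w, Or.inr ⟨rfl, hw⟩, v, hR.symm hw⟩

/-- The action of the morphism `α ⟶ β`. -/
noncomputable def stepMap {α β : IsoRoot n m} (f : α ⟶ β) (v : {v | ∃ w, R α v w}) :
    {v | ∃ w, R β v w} :=
  ⟨(hR.exists_step f v.2).choose, (hR.exists_step f v.2).choose_spec.2⟩

theorem stepMap_spec {α β : IsoRoot n m} (f : α ⟶ β) (v : {v | ∃ w, R α v w}) :
    ActionStep R α β v (hR.stepMap f v) :=
  (hR.exists_step f v.2).choose_spec.1

theorem stepMap_eq {α β : IsoRoot n m} (f : α ⟶ β) (v : {v | ∃ w, R α v w})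
    (w : {v | ∃ w, R β v w}) (h : ActionStep R α β v w) : hR.stepMap f v = w :=
  Subtype.ext (hR.step_unique (hR.stepMap_spec f v) h)

/-- The action with the arrows `R`. -/
noncomputable def toFunctor : IsoRoot n m ⥤ SymGroupoid V where
  obj α := ⟨{v | ∃ w, R α v w}⟩
  map f :=
    { toFun := hR.stepMap f
      invFun := hR.stepMap (Groupoid.inv f)
      left_inv := fun v => hR.stepMap_eq _ _ _ (hR.step_symm (hR.stepMap_spec f v))
      right_inv := fun v => hR.stepMap_eq _ _ _ (hR.step_symm (hR.stepMap_spec _ v)) }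
  map_id α := Equiv.ext fun _ => hR.stepMap_eq (𝟙 α) _ _ (Or.inl ⟨rfl, rfl⟩)
  map_comp f g := Equiv.ext fun v => hR.stepMap_eq (f ≫ g) _ _
    (hR.step_trans (hR.stepMap_spec f v) (hR.stepMap_spec g _))

theorem hasArrows_toFunctor : HasArrows hR.toFunctor R := by
  intro α v w
  have key (h : ∃ w, R α v w) : R α v (hR.stepMap α.rho ⟨v, h⟩) := by
    rcases hR.stepMap_spec α.rho ⟨v, h⟩ with ⟨e, -⟩ | ⟨-, h'⟩
    · exact absurd e (IsoRoot.neg_ne_self _)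
    · exact h'
  constructor
  · rintro ⟨h, rfl⟩
    exact key h
  · intro h
    exact ⟨show ∃ w, R α v w from ⟨w, h⟩, hR.unique (key ⟨w, h⟩) h⟩

end IsActionRel

theorem HasArrow.unique {G : IsoRoot n m ⥤ SymGroupoid V} {α : IsoRoot n m} {v w w' : V}
    (h : HasArrow G α v w) (h' : HasArrow G α v w') : w = w' :=
  h.2.symm.trans h'.2

/-- Needed for the loop `α ⟶ -α ⟶ - -α`, whose endpoint equals `α` only propositionally. After
substitution, proof irrelevance makes the loop the identity. -/
theorem toMap_map_endo (G : IsoRoot n m ⥤ SymGroupoid V) {α β : IsoRoot n m} (h : β = α)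
    (f : α ⟶ β) (x : (G.obj α).carrier) : (SymGroupoid.toMap (G.map f) x : V) = x := by
  subst h
  have : f = 𝟙 β := rfl
  rw [this, G.map_id]
  rfl

theorem HasArrow.symm {G : IsoRoot n m ⥤ SymGroupoid V} {α : IsoRoot n m} {v w : V}
    (h : HasArrow G α v w) : HasArrow G (-α) w v := by
  obtain ⟨hv, rfl⟩ := h
  refine ⟨Subtype.coe_prop _, ?_⟩
  have := toMap_map_endo G (IsoRoot.neg_neg' α) (α.rho ≫ (-α).rho) ⟨v, hv⟩
  rw [G.map_comp] at this
  exact this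

/-- An injective map which preserves arrows, and along which arrows lift, identifies orbits. -/
theorem exists_orbitIso {G : IsoRoot n m ⥤ SymGroupoid V} {G' : IsoRoot n m ⥤ SymGroupoid V'}
    {φ : V → V'} (hφ : Function.Injective φ)
    (hmap : ∀ α v w, HasArrow G α v w → HasArrow G' α (φ v) (φ w))
    (hlift : ∀ α v y, HasArrow G' α (φ v) y → ∃ w, HasArrow G α v w) {v : V} {v' : V'}
    (hv : φ v = v') :
    ∃ e : OrbitIso G v G' v', ∀ q, (e.toEquiv q : V') = φ q := by
  subst hv
  have harrow α a b : HasArrow G α a b ↔ HasArrow G' α (φ a) (φ b) := by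
    refine ⟨hmap α a b, fun h => ?_⟩
    obtain ⟨w, hw⟩ := hlift α a _ h
    rwa [← hφ ((hmap α a w hw).unique h)]
  have hmem (w) (hw : w ∈ orbit G v) : φ w ∈ orbit G' (φ v) := by
    induction hw with
    | rel x y h => exact Relation.EqvGen.rel _ _ (h.imp fun α => hmap α x y)
    | refl x => exact Relation.EqvGen.refl _
    | symm x y _ ih => exact Relation.EqvGen.symm _ _ ih
    | trans x y z _ _ ih ih' => exact Relation.EqvGen.trans _ _ _ ih ih'
  -- Paths lift from either end. Both directions are carried through the induction so that the
  -- symmetric case merely exchanges them; an arrow is lifted backwards through its inverse,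
  -- labelled `-α`.
  have hrange (x y : V') (h : Relation.EqvGen (fun a b => ∃ α, HasArrow G' α a b) x y) :
      (∀ a, φ a = x → ∃ b, φ b = y ∧ Relation.EqvGen (fun a b => ∃ α, HasArrow G α a b) a b) ∧
      ∀ b, φ b = y → ∃ a, φ a = x ∧ Relation.EqvGen (fun a b => ∃ α, HasArrow G α a b) b a := by
    induction h with
    | rel x y h =>
      obtain ⟨α, h⟩ := h
      constructor
      · rintro a rfl
        obtain ⟨b, hb⟩ := hlift α a y h
        exact ⟨b, (hmap α a b hb).unique h, Relation.EqvGen.rel _ _ ⟨α, hb⟩⟩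
      · rintro b rfl
        obtain ⟨a, ha⟩ := hlift (-α) b x h.symm
        exact ⟨a, (hmap _ b a ha).unique h.symm, Relation.EqvGen.rel _ _ ⟨-α, ha⟩⟩
    | refl x => exact ⟨fun a ha => ⟨a, ha, .refl _⟩, fun a ha => ⟨a, ha, .refl _⟩⟩
    | symm x y _ ih => exact ⟨ih.2, ih.1⟩
    | trans x y z _ _ ih ih' =>
      constructor
      · intro a ha
        obtain ⟨b, hb, h⟩ := ih.1 a ha
        obtain ⟨c, hc, h'⟩ := ih'.1 b hb
        exact ⟨c, hc, .trans _ _ _ h h'⟩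
      · intro c hc
        obtain ⟨b, hb, h⟩ := ih'.2 c hc
        obtain ⟨a, ha, h'⟩ := ih.2 b hb
        exact ⟨a, ha, .trans _ _ _ h h'⟩
  let f : orbit G v → orbit G' (φ v) := fun w => ⟨φ w, hmem w w.2⟩
  have hf : Function.Bijective f := by
    constructor
    · intro a b h
      exact Subtype.ext (hφ (congrArg Subtype.val h))
    · rintro ⟨y, hy⟩
      obtain ⟨b, rfl, hb⟩ := (hrange _ _ hy).1 v rfl
      exact ⟨⟨b, hb⟩, rfl⟩
  exact ⟨⟨Equiv.ofBijective f hf, fun α a b => harrow α a b⟩, fun q => rfl⟩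

end ActionLemmas

/-! ## Roots of the affinization -/

noncomputable section RootSpaces

variable {k : Type*} [Field k] {n m : ℕ}

@[simp] theorem coeff_euler (f : k[T;T⁻¹]) (p : ℤ) : (euler f).coeff p = p * f.coeff p := by
  classical
  rw [euler, AddMonoidAlgebra.coeff_finsuppSum, Finsupp.sum_apply, Finsupp.sum]
  simp only [← LaurentPolynomial.single_eq_C_mul_T, AddMonoidAlgebra.coeff_single,
    Finsupp.single_apply]
  rw [Finset.sum_ite_eq' f.coeff.support p fun q => (q : k) * f.coeff q]
  split_ifs with h
  · rfl
  · rw [Finsupp.notMem_support_iff.1 h, mul_zero]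

theorem cartan_apply_self {h : AffineGL k n m} (hh : h ∈ cartan k n m) (a : Idx n m) :
    h.1 a a = LaurentPolynomial.C (eps a ⟨h, hh⟩) := by
  ext p
  rw [LaurentPolynomial.C_apply]
  split_ifs with hp
  · subst hp; rfl
  · exact hh.2.2 a p hp

theorem cartan_fst_eq_diagonal (h : cartan k n m) :
    h.1.1 = Matrix.diagonal fun a => LaurentPolynomial.C (eps a h) := by
  ext1 a b
  by_cases hab : a = b
  · subst hab; rw [Matrix.diagonal_apply_eq, cartan_apply_self h.2]
  · rw [Matrix.diagonal_apply_ne _ hab, h.2.2.1 a b hab]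

/-- The weight `ε_a - ε_b + p δ̄`. -/
def affRoot (k : Type*) [Field k] (a b : Idx n m) (p : ℤ) : Module.Dual k (cartan k n m) :=
  eps a - eps b + p • deltaBar k n m

theorem affRoot_apply (a b : Idx n m) (p : ℤ) (h : cartan k n m) :
    affRoot k a b p h = eps a h - eps b h + p * deltaBar k n m h := by
  simp [affRoot]

theorem neg_affRoot (a b : Idx n m) (p : ℤ) : -affRoot k a b p = affRoot k b a (-p) := by
  simp only [affRoot, neg_smul]; abel

theorem affRoot_self (a b : Idx n m) (p : ℤ) : affRoot k a a p = affRoot k b b p := by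
  simp [affRoot]

@[simp] theorem evenPart_diagonal {A : Type*} [Zero A] (d : Idx n m → A) :
    evenPart (Matrix.diagonal d) = Matrix.diagonal d := by
  ext1 a b
  by_cases h : a = b
  · subst h; simp [evenPart]
  · simp [evenPart, h]

@[simp] theorem oddPart_diagonal {A : Type*} [Zero A] (d : Idx n m → A) :
    oddPart (Matrix.diagonal d) = 0 := by
  ext1 a b
  by_cases h : a = b
  · subst h; simp [oddPart]
  · simp [oddPart, h]

theorem evenPart_add_oddPart {A : Type*} [AddMonoid A] (x : Matrix (Idx n m) (Idx n m) A) :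
    evenPart x + oddPart x = x := by
  ext1 a b; simp only [evenPart, oddPart, Matrix.of_apply, Matrix.add_apply]; split_ifs <;> simp

theorem superComm_diagonal {A : Type*} [CommRing A] (d : Idx n m → A)
    (x : Matrix (Idx n m) (Idx n m) A) :
    superComm (Matrix.diagonal d) x = Matrix.diagonal d * x - x * Matrix.diagonal d := by
  simp only [superComm, evenPart_diagonal, oddPart_diagonal, mul_zero, add_zero, sub_zero]
  rw [← add_mul, evenPart_add_oddPart]

theorem map_euler_cartan (h : cartan k n m) : h.1.1.map euler = 0 := by
  ext a b p
  rw [cartan_fst_eq_diagonal, Matrix.map_apply, coeff_euler]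
  by_cases hab : a = b
  · subst hab
    rw [Matrix.diagonal_apply_eq, LaurentPolynomial.C_apply]
    split_ifs with hp <;> simp [hp]
  · simp [Matrix.diagonal_apply_ne _ hab]

theorem affBracket_cartan (h : cartan k n m) (x : AffineGL k n m) :
    affBracket h.1 x =
      (Matrix.of fun a b => (eps a h - eps b h) • x.1 a b + deltaBar k n m h • euler (x.1 a b),
        0, 0) := by
  refine Prod.ext ?_ (Prod.ext ?_ rfl)
  · simp only [affBracket, map_euler_cartan, smul_zero, sub_zero]
    rw [cartan_fst_eq_diagonal, superComm_diagonal]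
    ext1 a b
    simp only [Matrix.add_apply, Matrix.sub_apply, Matrix.diagonal_mul, Matrix.mul_diagonal,
      Matrix.smul_apply, Matrix.map_apply, Matrix.of_apply, sub_smul,
      LaurentPolynomial.smul_eq_C_mul]
    rw [mul_comm (x.1 a b)]
    rfl
  · simp [affBracket, map_euler_cartan, superTrace]

/-- The Cartan subalgebra acts diagonally: the coefficient of `t^p` in the entry `(a, b)` is scaled
by `ε_a - ε_b + p δ̄`, and the coordinates along `c` and `d` are killed. Hence weight spaces are
support conditions. -/
theorem mem_rootSpace_iff (γ : Module.Dual k (cartan k n m)) (x : AffineGL k n m) :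
    x ∈ rootSpace γ ↔ x ∈ affinization k n m ∧
      (∀ a b p, (x.1 a b).coeff p ≠ 0 → γ = affRoot k a b p) ∧ (γ ≠ 0 → x.2 = 0) := by
  change (_ ∧ _) ↔ _
  refine and_congr_right fun _ => ?_
  simp only [affBracket_cartan]
  constructor
  · intro h
    refine ⟨fun a b p hp => ?_, fun hγ => ?_⟩
    · ext y
      have := congrArg (fun z : AffineGL k n m => (z.1 a b).coeff p) (h y)
      simp only [Matrix.of_apply, Prod.smul_fst, Matrix.smul_apply, AddMonoidAlgebra.coeff_add,
        AddMonoidAlgebra.coeff_smul, Finsupp.add_apply, Finsupp.smul_apply, coeff_euler,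
        smul_eq_mul] at this
      rw [affRoot_apply]
      apply mul_right_cancel₀ hp
      rw [← this]; ring
    · obtain ⟨y, hy⟩ : ∃ y, γ y ≠ 0 := by
        by_contra! hc
        exact hγ (LinearMap.ext hc)
      have := congrArg Prod.snd (h y)
      exact (smul_eq_zero.1 this.symm).resolve_left hy
  · rintro ⟨h1, h2⟩ y
    refine Prod.ext ?_ ?_
    · ext a b p
      simp only [Matrix.of_apply, Prod.smul_fst, Matrix.smul_apply, AddMonoidAlgebra.coeff_add,
        AddMonoidAlgebra.coeff_smul, Finsupp.add_apply, Finsupp.smul_apply, coeff_euler,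
        smul_eq_mul]
      by_cases hp : (x.1 a b).coeff p = 0
      · simp [hp]
      · rw [h1 a b p hp, affRoot_apply]; ring
    · by_cases hγ : γ = 0
      · simp [hγ]
      · rw [Prod.smul_snd, h2 hγ, smul_zero]; rfl

/-- Only differences can be prescribed, because for `n ≠ m` the supertrace must vanish. A common
shift `c` of the diagonal changes the supertrace by `(n - m) c`, and `n - m` is invertible in
characteristic zero; for `n = m` degree zero is unrestricted. -/
theorem exists_cartan [CharZero k] (y : Idx n m → k) (z : k) :
    ∃ h : cartan k n m, (∀ a b, eps a h - eps b h = y a - y b) ∧ deltaBar k n m h = z := by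
  obtain ⟨c, hc⟩ : ∃ c : k, n ≠ m →
      ∑ i, (y (Sum.inl i) + c) - ∑ j, (y (Sum.inr j) + c) = 0 := by
    by_cases hnm : n = m
    · exact ⟨0, fun h => absurd hnm h⟩
    · have h0 : (n : k) - m ≠ 0 := sub_ne_zero.2 (Nat.cast_injective.ne hnm)
      refine ⟨(∑ j, y (Sum.inr j) - ∑ i, y (Sum.inl i)) / (n - m), fun _ => ?_⟩
      simp only [Finset.sum_add_distrib, Finset.sum_const, Finset.card_univ, Fintype.card_fin,
        nsmul_eq_mul]
      field_simp
      ring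
  let M : Matrix (Idx n m) (Idx n m) k[T;T⁻¹] :=
    Matrix.diagonal fun a => LaurentPolynomial.C (y a + c)
  have hM : ((M, 0, z) : AffineGL k n m) ∈ cartan k n m := by
    refine ⟨fun p hp => ?_, fun a b hab => Matrix.diagonal_apply_ne _ hab, fun a p hp => ?_⟩
    · simp only [superTrace, M, Matrix.diagonal_apply_eq, ← map_sum, ← map_sub,
        LaurentPolynomial.C_apply]
      split_ifs with h
      · exact hc (hp.resolve_right (not_not.2 h))
      · rfl
    · simp [M, hp]
  refine ⟨⟨_, hM⟩, fun a b => ?_, rfl⟩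
  change (M a a).coeff 0 - (M b b).coeff 0 = _
  simp [M]

/-- Evaluation at suitable Cartan elements isolates `p`, then the positions of `a` and `b`.
Distinctness of `a` and `b` is essential: `ε_a - ε_a + p δ̄` does not see `a`. -/
theorem affRoot_inj [CharZero k] {a b c d : Idx n m} {p q : ℤ} (hab : a ≠ b)
    (h : affRoot k a b p = affRoot k c d q) : a = c ∧ b = d ∧ p = q := by
  classical
  have key (y : Idx n m → k) (z : k) : y a - y b + p * z = y c - y d + q * z := by
    obtain ⟨g, h1, h2⟩ := exists_cartan y z
    have := LinearMap.congr_fun h g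
    rwa [affRoot_apply, affRoot_apply, h1, h1, h2] at this
  have hpq : p = q := by simpa using key 0 1
  subst hpq
  have ha := key (Pi.single a 1) 0
  have hb := key (Pi.single b 1) 0
  simp only [Pi.single_apply, hab, hab.symm, if_true, if_false] at ha hb
  refine ⟨?_, ?_, rfl⟩
  · by_contra hne
    rw [if_neg (Ne.symm hne)] at ha
    split_ifs at ha
    -- In this branch `d = a`, so the coefficient of `ε_a` is `1` on one side and `-1` on the other.
    · have : (2 : k) = 0 := by linear_combination ha
      exact two_ne_zero this
    · simp at ha
  · by_contra hne
    rw [if_neg (Ne.symm hne)] at hb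
    split_ifs at hb
    · have : (2 : k) = 0 := by linear_combination -hb
      exact two_ne_zero this
    · simp at hb

end RootSpaces

/-! ## Borel subalgebras given by height functions -/

section Heights

variable {n m : ℕ}

/-- The height of the root `ε_a - ε_b + p δ̄` with respect to `f`. -/
def affHeight (f : Idx n m → ℤ) (a b : Idx n m) (p : ℤ) : ℤ := f b - f a + p * ((n : ℤ) + m)

theorem affHeight_add (f : Idx n m → ℤ) (a b c : Idx n m) (p q : ℤ) :
    affHeight f a b p + affHeight f b c q = affHeight f a c (p + q) := by
  simp only [affHeight]; ring

theorem affHeight_neg (f : Idx n m → ℤ) (a b : Idx n m) (p : ℤ) :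
    affHeight f b a (-p) = -affHeight f a b p := by
  simp only [affHeight]; ring

theorem affHeight_self (f : Idx n m → ℤ) (a : Idx n m) (p : ℤ) :
    affHeight f a a p = p * ((n : ℤ) + m) := by
  simp [affHeight]

/-- The values of `f` represent every residue class modulo `n + m` exactly once. -/
structure IsAffineOrder (f : Idx n m → ℤ) : Prop where
  inj : ∀ {a b p}, affHeight f a b p = 0 → a = b
  surj : ∀ x, ∃ c t, f c + t * ((n : ℤ) + m) = x

namespace IsAffineOrder

variable {f g : Idx n m → ℤ}

/-- The position following that of `a` is occupied, and not by a translate of `a`, since `1` is not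
a multiple of `n + m ≥ 2`. -/
theorem exists_simple (hf : IsAffineOrder f) (hN : 2 ≤ n + m) (a : Idx n m) :
    ∃ c t, c ≠ a ∧ affHeight f a c t = 1 := by
  obtain ⟨c, t, h⟩ := hf.surj (f a + 1)
  refine ⟨c, t, ?_, by simp only [affHeight]; linarith⟩
  rintro rfl
  have h1 : t * ((n : ℤ) + m) = 1 := by linarith
  have h2 := Int.eq_one_or_neg_one_of_mul_eq_one (by rwa [mul_comm] at h1 : ((n : ℤ) + m) * t = 1)
  omega

theorem ne_zero (hf : IsAffineOrder f) {a b : Idx n m} (hab : a ≠ b) (p : ℤ) :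
    affHeight f a b p ≠ 0 := fun h => hab (hf.inj h)

/-- Two affine orders with the same positive roots have the same simple roots. -/
theorem height_eq_one (hf : IsAffineOrder f) (hg : IsAffineOrder g) (hN : 2 ≤ n + m)
    (h : ∀ a b p, a ≠ b → 0 ≤ affHeight f a b p → 0 ≤ affHeight g a b p)
    (h' : ∀ a b p, a ≠ b → 0 ≤ affHeight g a b p → 0 ≤ affHeight f a b p)
    {a b : Idx n m} {p : ℤ} (hab : a ≠ b) (h1 : affHeight f a b p = 1) :
    affHeight g a b p = 1 := by
  have hp := h a b p hab (by omega)
  have hp' := hg.ne_zero hab p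
  by_contra hne
  -- If the height for `g` exceeds one, split off the `g`-simple root starting at `a`. Both summands
  -- are positive for `g`, hence for `f`, so the height for `f` would be at least two. When `c = b`
  -- the remainder is a multiple of `δ̄`, whose height does not depend on the order.
  obtain ⟨c, t, hca, hc⟩ := hg.exists_simple hN a
  have e1 := affHeight_add g a c b t (p - t)
  have e2 := affHeight_add f a c b t (p - t)
  rw [add_sub_cancel] at e1 e2
  have e3 := h' a c t hca.symm (by omega)
  have e4 := hf.ne_zero hca.symm t
  rcases eq_or_ne c b with rfl | hcb
  · rw [affHeight_self] at e1 e2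
    omega
  · have e5 := h' c b (p - t) hcb (by omega)
    have e6 := hf.ne_zero hcb (p - t)
    omega

/-- The height counts simple roots in a chain from `a` to `b`, and the simple roots of the two
orders agree. Induction on the height removes one simple root at a time. -/
theorem sub_eq_sub (hf : IsAffineOrder f) (hg : IsAffineOrder g) (hN : 2 ≤ n + m)
    (h : ∀ a b p, a ≠ b → 0 ≤ affHeight f a b p → 0 ≤ affHeight g a b p)
    (h' : ∀ a b p, a ≠ b → 0 ≤ affHeight g a b p → 0 ≤ affHeight f a b p) (a b : Idx n m) :
    f b - f a = g b - g a := by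
  have key (d : ℕ) : ∀ a p, affHeight f a b p = d → affHeight g a b p = d := by
    induction d with
    | zero =>
      intro a p hp
      obtain rfl := hf.inj hp
      rwa [affHeight_self] at hp ⊢
    | succ d ih =>
      intro a p hp
      obtain ⟨c, t, hca, hc⟩ := hf.exists_simple hN a
      have e1 := affHeight_add g a c b t (p - t)
      have e2 := affHeight_add f a c b t (p - t)
      rw [add_sub_cancel] at e1 e2
      have e3 := ih c (p - t) (by push_cast at hp; omega)
      have e4 := hf.height_eq_one hg hN h h' hca.symm hc
      push_cast
      omega
  -- The chain argument covers only nonnegative heights. Any large enough multiple of `δ̄` may be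
  -- added, since it contributes equally for `f` and `g`.
  have hpos : 0 ≤ affHeight f a b |f b - f a| := by
    have h1 := neg_abs_le (f b - f a)
    have h2 := abs_nonneg (f b - f a)
    simp only [affHeight]
    nlinarith
  have := key _ a |f b - f a| (Int.toNat_of_nonneg hpos).symm
  rw [Int.toNat_of_nonneg hpos] at this
  simp only [affHeight] at this
  linarith

end IsAffineOrder

/-- The positive roots for `g` are those for `f`, with `ε_a - ε_b + p δ̄` replaced by its
negative. -/
def IsHeightReflection (f g : Idx n m → ℤ) (a b : Idx n m) (p : ℤ) : Prop :=
  0 ≤ affHeight f a b p ∧ ∀ c d q, c ≠ d → (0 ≤ affHeight g c d q ↔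
    (c = b ∧ d = a ∧ q = -p) ∨ (¬(c = a ∧ d = b ∧ q = p) ∧ 0 ≤ affHeight f c d q))

/-- A decomposable positive root cannot be the only one to change sign: its two positive summands
would remain positive for `g`, while their sum becomes negative. -/
theorem IsHeightReflection.height_eq_one {f g : Idx n m → ℤ} (hf : IsAffineOrder f)
    (hg : IsAffineOrder g) (hN : 2 ≤ n + m) {a b : Idx n m} (hab : a ≠ b) {p : ℤ}
    (h : IsHeightReflection f g a b p) : affHeight f a b p = 1 := by
  obtain ⟨h0, h⟩ := h
  have h0' := hf.ne_zero hab p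
  by_contra hne
  obtain ⟨c, t, hca, hc⟩ := hf.exists_simple hN a
  have e1 := affHeight_add g a c b t (p - t)
  have e2 := affHeight_add f a c b t (p - t)
  rw [add_sub_cancel] at e1 e2
  have e3 : 0 ≤ affHeight g a c t := by
    refine (h a c t hca.symm).2 (Or.inr ⟨?_, by omega⟩)
    rintro ⟨-, rfl, rfl⟩
    omega
  have e4 : 0 ≤ affHeight g b a (-p) := (h b a (-p) hab.symm).2 (Or.inl ⟨rfl, rfl, rfl⟩)
  rw [affHeight_neg] at e4
  have e5 := hg.ne_zero hab p
  -- If the simple root already ends at `b`, the remainder is `(p - t) δ̄`. Its height is the same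
  -- for `f` and `g`, but would have to be positive for `f` and negative for `g`.
  rcases eq_or_ne c b with rfl | hcb
  · rw [affHeight_self] at e1 e2
    omega
  · have e6 : 0 ≤ affHeight g c b (p - t) := by
      refine (h c b (p - t) hcb).2 (Or.inr ⟨?_, by omega⟩)
      rintro ⟨rfl, -, -⟩
      exact hca rfl
    omega

/-- A root involving exactly one of `a`, `b` changes its height by one, and heights of roots between
distinct indices never vanish, so its sign persists. Only roots between `a` and `b` change by two.
-/
theorem isHeightReflection_of_swap {f g : Idx n m → ℤ} (hf : IsAffineOrder f)
    (hg : IsAffineOrder g) (hN : 2 ≤ n + m) {a b : Idx n m} (hab : a ≠ b) {p : ℤ}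
    (h1 : affHeight f a b p = 1) (ha : g a = f a + 1) (hb : g b = f b - 1)
    (hc : ∀ c, c ≠ a → c ≠ b → g c = f c) : IsHeightReflection f g a b p := by
  refine ⟨by omega, fun c d q hcd => ?_⟩
  have hf0 := hf.ne_zero hcd q
  have hg0 := hg.ne_zero hcd q
  -- The other roots from `a` to `b` have height `1 + r (n + m)` with `r ≠ 0`, hence at least `3` or
  -- at most `-1`. Lowering by two does not change the sign.
  have hmul : ∀ r : ℤ, r ≠ 0 → 2 ≤ r * ((n : ℤ) + m) ∨ r * ((n : ℤ) + m) ≤ -2 := by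
    intro r hr
    rcases lt_or_gt_of_ne hr with h | h
    · right; nlinarith
    · left; nlinarith
  by_cases hca : c = a
  · subst hca
    by_cases hdb : d = b
    · subst hdb
      have hq : (q - p) * ((n : ℤ) + m) = q * ((n : ℤ) + m) - p * ((n : ℤ) + m) := by ring
      have := hmul (q - p)
      have hqp : q - p = 0 ↔ q = p := sub_eq_zero
      by_cases hqp : q = p
      · subst hqp
        simp only [affHeight] at *
        simp [hab]
        omega
      · have := hmul (q - p) (sub_ne_zero.2 hqp)
        simp only [affHeight] at *
        simp only [hab, hqp, false_and, and_false, not_false_eq_true, true_and, false_or]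
        omega
    · have := hc d hcd.symm hdb
      simp only [affHeight] at *
      simp only [hab, hdb, false_and, and_false, not_false_eq_true, true_and, false_or]
      omega
  · by_cases hcb : c = b
    · subst hcb
      by_cases hda : d = a
      · subst hda
        have hq : (q + p) * ((n : ℤ) + m) = q * ((n : ℤ) + m) + p * ((n : ℤ) + m) := by ring
        by_cases hqp : q = -p
        · subst hqp
          simp only [affHeight] at *
          simp
          linarith
        · have := hmul (q + p) (fun h => hqp (by omega))
          simp only [affHeight] at *
          simp only [hca, hqp, false_and, and_false, not_false_eq_true, true_and, false_or]
          omega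
      · have := hc d hda hcd.symm
        simp only [affHeight] at *
        simp only [hca, hda, false_and, and_false, not_false_eq_true, true_and, false_or]
        omega
    · have := hc c hca hcb
      by_cases hda : d = a
      · subst hda
        simp only [affHeight] at *
        simp only [hca, hcb, false_and, not_false_eq_true, true_and, false_or]
        omega
      · by_cases hdb : d = b
        · subst hdb
          simp only [affHeight] at *
          simp only [hca, hcb, false_and, not_false_eq_true, true_and, false_or]
          omega
        · have := hc d hda hdb
          simp only [affHeight] at *
          simp only [hca, hcb, false_and, not_false_eq_true, true_and, false_or]
          omega

end Heights

/-! ### The subalgebra of nonnegative height and its root spaces -/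

noncomputable section HeightBorel

variable {k : Type*} [Field k] {n m : ℕ}

/-- The matrices supported on roots of nonnegative height. -/
def NonnegSupport (f : Idx n m → ℤ) (M : Matrix (Idx n m) (Idx n m) k[T;T⁻¹]) : Prop :=
  ∀ a b p, (M a b).coeff p ≠ 0 → 0 ≤ affHeight f a b p

namespace NonnegSupport

variable {f : Idx n m → ℤ} {M M' : Matrix (Idx n m) (Idx n m) k[T;T⁻¹]}

theorem add (h : NonnegSupport f M) (h' : NonnegSupport f M') : NonnegSupport f (M + M') := by
  intro a b p hp
  by_contra hc
  have h1 : (M a b).coeff p = 0 := by by_contra h1; exact hc (h a b p h1)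
  have h2 : (M' a b).coeff p = 0 := by by_contra h2; exact hc (h' a b p h2)
  simp [h1, h2] at hp

theorem sub (h : NonnegSupport f M) (h' : NonnegSupport f M') : NonnegSupport f (M - M') := by
  intro a b p hp
  by_contra hc
  have h1 : (M a b).coeff p = 0 := by by_contra h1; exact hc (h a b p h1)
  have h2 : (M' a b).coeff p = 0 := by by_contra h2; exact hc (h' a b p h2)
  simp [h1, h2] at hp

theorem smul (c : k) (h : NonnegSupport f M) : NonnegSupport f (c • M) := by
  intro a b p hp
  refine h a b p fun h0 => hp ?_
  simp [h0]

theorem map_euler (h : NonnegSupport f M) : NonnegSupport f (M.map euler) := by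
  intro a b p hp
  refine h a b p fun h0 => hp ?_
  simp [h0]

theorem even (h : NonnegSupport f M) : NonnegSupport f (evenPart M) := by
  intro a b p hp
  refine h a b p fun h0 => hp ?_
  simp only [evenPart, Matrix.of_apply]
  split_ifs <;> simp [h0]

theorem odd (h : NonnegSupport f M) : NonnegSupport f (oddPart M) := by
  intro a b p hp
  refine h a b p fun h0 => hp ?_
  simp only [oddPart, Matrix.of_apply]
  split_ifs <;> simp [h0]

theorem mul (h : NonnegSupport f M) (h' : NonnegSupport f M') : NonnegSupport f (M * M') := by
  classical
  intro a c p hp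
  rw [Matrix.mul_apply, AddMonoidAlgebra.coeff_sum, Finsupp.finsetSum_apply] at hp
  obtain ⟨b, -, hb⟩ := Finset.exists_ne_zero_of_sum_ne_zero hp
  rw [AddMonoidAlgebra.coeff_mul] at hb
  obtain ⟨q, -, hq⟩ := Finset.exists_ne_zero_of_sum_ne_zero hb
  obtain ⟨r, -, hr⟩ := Finset.exists_ne_zero_of_sum_ne_zero hq
  simp only [ne_eq, ite_eq_right_iff, not_forall, mul_eq_zero, not_or] at hr
  obtain ⟨rfl, h1, h2⟩ := hr
  rw [← affHeight_add f a b c]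
  exact add_nonneg (h a b q h1) (h' b c r h2)

theorem superComm (h : NonnegSupport f M) (h' : NonnegSupport f M') :
    NonnegSupport f (superComm M M') :=
  (h.mul h').sub ((((h'.even.mul h.even).add (h'.even.mul h.odd)).add (h'.odd.mul h.even)).sub
    (h'.odd.mul h.odd))

end NonnegSupport

/-- Exchanging summations cancels block by block; for odd blocks the sign of the supertrace is
compensated by the plus sign of the anticommutator. This keeps the affinization closed under the
bracket. -/
theorem superTrace_superComm {A : Type*} [CommRing A] (x y : Matrix (Idx n m) (Idx n m) A) :
    superTrace (superComm x y) = 0 := by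
  have h1 : ∑ i : Fin n, ∑ i' : Fin n, x (Sum.inl i) (Sum.inl i') * y (Sum.inl i') (Sum.inl i) =
      ∑ i : Fin n, ∑ i' : Fin n, y (Sum.inl i) (Sum.inl i') * x (Sum.inl i') (Sum.inl i) := by
    rw [Finset.sum_comm]; simp only [mul_comm]
  have h2 : ∑ j : Fin m, ∑ j' : Fin m, x (Sum.inr j) (Sum.inr j') * y (Sum.inr j') (Sum.inr j) =
      ∑ j : Fin m, ∑ j' : Fin m, y (Sum.inr j) (Sum.inr j') * x (Sum.inr j') (Sum.inr j) := by
    rw [Finset.sum_comm]; simp only [mul_comm]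
  have h3 : ∑ i : Fin n, ∑ j : Fin m, x (Sum.inl i) (Sum.inr j) * y (Sum.inr j) (Sum.inl i) =
      ∑ j : Fin m, ∑ i : Fin n, y (Sum.inr j) (Sum.inl i) * x (Sum.inl i) (Sum.inr j) := by
    rw [Finset.sum_comm]; simp only [mul_comm]
  have h4 : ∑ j : Fin m, ∑ i : Fin n, x (Sum.inr j) (Sum.inl i) * y (Sum.inl i) (Sum.inr j) =
      ∑ i : Fin n, ∑ j : Fin m, y (Sum.inl i) (Sum.inr j) * x (Sum.inr j) (Sum.inl i) := by
    rw [Finset.sum_comm]; simp only [mul_comm]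
  simp only [superTrace, superComm, Matrix.sub_apply, Matrix.add_apply, Matrix.mul_apply,
    Fintype.sum_sum_type, evenPart, oddPart, Matrix.of_apply, Sum.isLeft_inl, Sum.isLeft_inr,
    if_true, Bool.true_eq_false, Bool.false_eq_true, if_false, zero_mul, mul_zero,
    Finset.sum_const_zero, add_zero, zero_add, Finset.sum_sub_distrib,
    Finset.sum_add_distrib]
  linear_combination h1 - h2 + h3 - h4

theorem coeff_superTrace_map_euler (x : Matrix (Idx n m) (Idx n m) k[T;T⁻¹]) (p : ℤ) :
    (superTrace (x.map euler)).coeff p = p * (superTrace x).coeff p := by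
  simp [superTrace, AddMonoidAlgebra.coeff_sum, mul_sub, Finset.mul_sum]

theorem affBracket_mem_affinization {x y : AffineGL k n m} (hx : x ∈ affinization k n m)
    (hy : y ∈ affinization k n m) : affBracket x y ∈ affinization k n m := by
  intro p hp
  have e : superTrace (affBracket x y).1 =
      x.2.2 • superTrace (y.1.map euler) - y.2.2 • superTrace (x.1.map euler) := by
    simp only [affBracket, sub_eq_add_neg, ← neg_smul, superTrace_add, superTrace_smul,
      superTrace_superComm, zero_add]
  rw [e]
  simp [coeff_superTrace_map_euler, hx p hp, hy p hp]

variable (k) in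
/-- The subalgebra of the affinization spanned by the root spaces of nonnegative height. -/
def heightBorel (f : Idx n m → ℤ) : Submodule k (AffineGL k n m) where
  carrier := {x | x ∈ affinization k n m ∧ NonnegSupport f x.1}
  add_mem' hx hy := ⟨add_mem hx.1 hy.1, hx.2.add hy.2⟩
  zero_mem' := ⟨zero_mem _, fun _ _ _ h => absurd rfl h⟩
  smul_mem' c _ hx := ⟨Submodule.smul_mem _ c hx.1, hx.2.smul c⟩

theorem affBracket_mem_heightBorel {f : Idx n m → ℤ} {x y : AffineGL k n m}
    (hx : x ∈ heightBorel k f) (hy : y ∈ heightBorel k f) : affBracket x y ∈ heightBorel k f :=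
  ⟨affBracket_mem_affinization hx.1 hy.1,
    ((hx.2.superComm hy.2).add (hy.2.map_euler.smul _)).sub (hx.2.map_euler.smul _)⟩

theorem heightBorel_congr {f g : Idx n m → ℤ} (h : ∀ a b, f b - f a = g b - g a) :
    heightBorel k f = heightBorel k g := by
  have : (NonnegSupport (k := k) f) = NonnegSupport g := by
    unfold NonnegSupport affHeight
    simp only [h]
  ext x
  change (_ ∧ _) ↔ (_ ∧ _)
  rw [this]

theorem cartan_le_heightBorel (f : Idx n m → ℤ) : cartan k n m ≤ heightBorel k f := by
  refine fun x hx => ⟨hx.1, fun a b p hp => ?_⟩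
  by_cases hab : a = b
  · subst hab
    by_cases h0 : p = 0
    · simp [h0, affHeight]
    · exact absurd (hx.2.2 a p h0) hp
  · rw [hx.2.1 a b hab] at hp
    exact absurd rfl hp

/-- The grading element of the order: it turns heights into values of weights, so that heights make
sense on the `ℕ`-span of the simple roots. -/
theorem exists_cartan_affHeight [CharZero k] (f : Idx n m → ℤ) :
    ∃ h : cartan k n m, ∀ a b p, affRoot k a b p h = affHeight f a b p := by
  obtain ⟨h, h1, h2⟩ := exists_cartan (k := k) (fun a : Idx n m => -(f a : k)) ((n : k) + m)
  refine ⟨h, fun a b p => ?_⟩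
  rw [affRoot_apply, h1, h2, affHeight]
  push_cast
  ring

theorem single_mem_rootSpace {a b : Idx n m} (hab : a ≠ b) (p : ℤ) (c : k) :
    ((Matrix.single a b (AddMonoidAlgebra.single p c), 0, 0) : AffineGL k n m) ∈
      rootSpace (affRoot k a b p) := by
  classical
  rw [mem_rootSpace_iff]
  refine ⟨fun q _ => ?_, fun a' b' q hq => ?_, fun _ => rfl⟩
  · have : superTrace (Matrix.single a b (AddMonoidAlgebra.single p c)) = 0 := by
      have (x : Idx n m) : Matrix.single a b (AddMonoidAlgebra.single p c) x x = 0 :=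
        Matrix.single_apply_of_ne _ _ _ _ _ (by rintro ⟨rfl, rfl⟩; exact hab rfl)
      simp only [superTrace, this, Finset.sum_const_zero, sub_zero]
    exact congrArg (fun z : k[T;T⁻¹] => z.coeff q) this
  · simp only [Matrix.single_apply] at hq
    split_ifs at hq with h
    · obtain ⟨rfl, rfl⟩ := h
      rw [AddMonoidAlgebra.coeff_single, Finsupp.single_apply] at hq
      split_ifs at hq with h
      · rw [h]
      · exact absurd rfl hq
    · exact absurd rfl hq

theorem rootSpace_affRoot_le_iff [CharZero k] (f : Idx n m → ℤ) {a b : Idx n m} (hab : a ≠ b)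
    (p : ℤ) : rootSpace (affRoot k a b p) ≤ heightBorel k f ↔ 0 ≤ affHeight f a b p := by
  constructor
  · intro h
    refine (h (single_mem_rootSpace hab p 1)).2 a b p ?_
    simp
  · intro h x hx
    rw [mem_rootSpace_iff] at hx
    refine ⟨hx.1, fun a' b' q hq => ?_⟩
    obtain ⟨rfl, rfl, rfl⟩ := affRoot_inj hab (hx.2.1 a' b' q hq)
    exact h

/-- Such a weight space is supported on the diagonal, where the height `p (n + m)` does not involve
the order. -/
theorem rootSpace_le_heightBorel_iff {f g : Idx n m → ℤ} {γ : Module.Dual k (cartan k n m)}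
    (hγ : ∀ a b p, a ≠ b → γ ≠ affRoot k a b p) :
    rootSpace γ ≤ heightBorel k f ↔ rootSpace γ ≤ heightBorel k g := by
  have key (f g : Idx n m → ℤ) (h : rootSpace γ ≤ heightBorel k f) :
      rootSpace γ ≤ heightBorel k g := by
    intro x hx
    refine ⟨(h hx).1, fun a b p hp => ?_⟩
    have h1 := (h hx).2 a b p hp
    obtain rfl : a = b := by
      by_contra hab
      exact hγ a b p hab (((mem_rootSpace_iff γ x).1 hx).2.1 a b p hp)
    rwa [affHeight_self] at h1 ⊢
  exact ⟨key f g, key g f⟩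

/-- Weights other than `ε_a - ε_b + p δ̄` with `a ≠ b` do not distinguish the Borel subalgebras, and
those roots are determined by their index triples. The Lie-theoretic condition thus becomes purely
combinatorial. -/
theorem isReflection_heightBorel_iff [CharZero k] (f g : Idx n m → ℤ) {a b : Idx n m}
    (hab : a ≠ b) (p : ℤ) :
    IsReflection (affRoot k a b p) (heightBorel k f) (heightBorel k g) ↔
      IsHeightReflection f g a b p := by
  have heq {c d : Idx n m} (hcd : c ≠ d) (q : ℤ) (a b : Idx n m) (p : ℤ) :
      affRoot k c d q = affRoot k a b p ↔ c = a ∧ d = b ∧ q = p :=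
    ⟨fun h => affRoot_inj hcd h, by rintro ⟨rfl, rfl, rfl⟩; rfl⟩
  refine and_congr (rootSpace_affRoot_le_iff f hab p) ⟨fun h c d q hcd => ?_, fun h γ => ?_⟩
  · have := h (affRoot k c d q)
    rwa [rootSpace_affRoot_le_iff g hcd, rootSpace_affRoot_le_iff f hcd, neg_affRoot, heq hcd,
      ne_eq, heq hcd] at this
  · by_cases hγ : ∃ c d q, c ≠ d ∧ γ = affRoot k c d q
    · obtain ⟨c, d, q, hcd, rfl⟩ := hγ
      rw [rootSpace_affRoot_le_iff g hcd, rootSpace_affRoot_le_iff f hcd, neg_affRoot, heq hcd,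
        ne_eq, heq hcd]
      exact h c d q hcd
    · push Not at hγ
      rw [rootSpace_le_heightBorel_iff (f := g) (g := f) hγ, neg_affRoot]
      simp [hγ a b p hab, hγ b a (-p) hab.symm]

theorem heightBorel_eq_of_le_iff {f g : Idx n m → ℤ}
    (h : ∀ a b p, a ≠ b → (0 ≤ affHeight f a b p ↔ 0 ≤ affHeight g a b p)) :
    heightBorel k f = heightBorel k g := by
  have : (NonnegSupport (k := k) f) = NonnegSupport g := by
    funext M
    refine propext (forall_congr' fun a => forall_congr' fun b => forall_congr' fun p =>
      imp_congr_right fun _ => ?_)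
    rcases eq_or_ne a b with rfl | hab
    · rw [affHeight_self, affHeight_self]
    · exact h a b p hab
  ext x
  change (_ ∧ _) ↔ (_ ∧ _)
  rw [this]

/-- The part of the diagonal of `x` of degree `p`. -/
def diagonalLayer (x : Matrix (Idx n m) (Idx n m) k[T;T⁻¹]) (p : ℤ) :
    Matrix (Idx n m) (Idx n m) k[T;T⁻¹] :=
  Matrix.diagonal fun a => AddMonoidAlgebra.single p ((x a a).coeff p)

/-- The diagonal of one degree is kept whole, because its individual entries may violate the
supertrace condition. -/
theorem diagonalLayer_mem_rootSpace {x : AffineGL k n m} (hx : x ∈ affinization k n m) (p : ℤ)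
    (a : Idx n m) :
    ((diagonalLayer x.1 p, 0, 0) : AffineGL k n m) ∈ rootSpace (affRoot k a a p) := by
  rw [mem_rootSpace_iff]
  refine ⟨fun q hq => ?_, fun a' b' q hq => ?_, fun _ => rfl⟩
  · have := hx q hq
    simp only [superTrace, diagonalLayer, Matrix.diagonal_apply_eq, AddMonoidAlgebra.coeff_sub,
      AddMonoidAlgebra.coeff_sum, AddMonoidAlgebra.coeff_single, Finsupp.sub_apply,
      Finsupp.finsetSum_apply, Finsupp.single_apply] at this ⊢
    split_ifs with h
    · rw [h]; exact this
    · simp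
  · by_cases hab : a' = b'
    · subst hab
      simp only [diagonalLayer, Matrix.diagonal_apply_eq, AddMonoidAlgebra.coeff_single,
        Finsupp.single_apply] at hq
      split_ifs at hq with h
      · rw [← h]; exact affRoot_self a a' p
      · exact absurd rfl hq
    · simp only [diagonalLayer, Matrix.diagonal_apply_ne _ hab] at hq
      exact absurd rfl hq

/-- A Borel subalgebra whose simple roots have positive height and generate all roots of
nonnegative height. -/
theorem borelOf_eq_heightBorel [CharZero k] {f : Idx n m → ℤ}
    {S : Set (Module.Dual k (cartan k n m))}
    (h1 : ∀ β ∈ S, ∃ a b p, β = affRoot k a b p ∧ 0 ≤ affHeight f a b p)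
    (h2 : ∀ a b p, 0 ≤ affHeight f a b p → affRoot k a b p ∈ AddSubmonoid.closure S) :
    borelOf S = heightBorel k f := by
  classical
  apply le_antisymm
  · refine sInf_le ⟨?_, fun x hx y hy => affBracket_mem_heightBorel hx hy⟩
    rintro x (hx | hx)
    · exact cartan_le_heightBorel f hx
    · simp only [Set.mem_iUnion] at hx
      obtain ⟨β, hβ, hx⟩ := hx
      have hx' := (mem_rootSpace_iff β x).1 hx
      refine ⟨hx'.1, fun a b p hp => ?_⟩
      obtain ⟨h, hh⟩ := exists_cartan_affHeight (k := k) f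
      -- The generators take natural values at the grading element, hence so does their `ℕ`-span. A
      -- root in that span therefore has nonnegative height.
      have hnat : ∃ N : ℕ, β h = N := by
        clear hx hx'
        induction hβ using AddSubmonoid.closure_induction with
        | mem β hβ =>
          obtain ⟨a, b, p, rfl, h0⟩ := h1 β hβ
          refine ⟨(affHeight f a b p).toNat, ?_⟩
          rw [hh, ← Int.cast_natCast, Int.toNat_of_nonneg h0]
        | zero => exact ⟨0, by simp⟩
        | add β γ _ _ ih ih' =>
          obtain ⟨N, hN⟩ := ih
          obtain ⟨N', hN'⟩ := ih'
          exact ⟨N + N', by simp [hN, hN']⟩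
      obtain ⟨N, hN⟩ := hnat
      rw [hx'.2.1 a b p hp, hh, ← Int.cast_natCast, Int.cast_inj] at hN
      omega
  · refine le_sInf ?_
    rintro W ⟨hW, -⟩ x ⟨hx, hxf⟩
    have hroot {a b p} (hp : 0 ≤ affHeight f a b p) {y : AffineGL k n m}
        (hy : y ∈ rootSpace (affRoot k a b p)) : y ∈ W :=
      hW (Or.inr (Set.mem_biUnion (h2 a b p hp) hy))
    have hcart : ((0, x.2) : AffineGL k n m) ∈ W := by
      refine hW (Or.inl ⟨fun p _ => ?_, fun _ _ _ => rfl, fun _ _ _ => rfl⟩)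
      simp [superTrace]
    let s : Finset ℤ := Finset.univ.biUnion fun a => Finset.univ.biUnion fun b =>
      (x.1 a b).coeff.support
    have hs (a b : Idx n m) : x.1 a b = ∑ p ∈ s, AddMonoidAlgebra.single p ((x.1 a b).coeff p) := by
      conv_lhs => rw [← AddMonoidAlgebra.sum_coeff_single (x.1 a b)]
      refine Finsupp.sum_of_support_subset _ (fun p hp => ?_) _ (by simp)
      exact Finset.mem_biUnion.2
        ⟨a, Finset.mem_univ _, Finset.mem_biUnion.2 ⟨b, Finset.mem_univ _, hp⟩⟩
    -- Every summand is either in the Cartan subalgebra or a weight vector: the `c`, `d` part, one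
    -- diagonal layer for each degree, and multiples of off-diagonal matrix units.
    have hdecomp : x = (0, x.2) + ∑ p ∈ s, ((diagonalLayer x.1 p, 0, 0) +
        ∑ a, ∑ b, if a = b then (0 : AffineGL k n m) else
          (Matrix.single a b (AddMonoidAlgebra.single p ((x.1 a b).coeff p)), 0, 0)) := by
      refine Prod.ext ?_ ?_
      · ext1 a b
        rw [hs a b]
        rw [Prod.fst_add, Prod.fst_sum, Matrix.add_apply]
        refine Eq.trans ?_ (zero_add _).symm
        simp only [Matrix.sum_apply, Prod.fst_add, Prod.fst_sum, Matrix.add_apply]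
        refine Finset.sum_congr rfl fun p _ => ?_
        rw [Finset.sum_eq_single a, Finset.sum_eq_single b]
        · by_cases hab : a = b
          · subst hab
            simp [diagonalLayer]
          · simp [diagonalLayer, hab]
        · intro b' _ hb'
          split_ifs
          · rfl
          · exact Matrix.single_apply_of_ne _ _ _ _ _ (fun h => hb' h.2)
        · simp
        · intro a' _ ha'
          refine Finset.sum_eq_zero fun b' _ => ?_
          split_ifs
          · rfl
          · exact Matrix.single_apply_of_ne _ _ _ _ _ (fun h => ha' h.1)
        · simp
      · rw [Prod.snd_add, Prod.snd_sum, Finset.sum_eq_zero, add_zero]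
        intro p _
        rw [Prod.snd_add, Prod.snd_sum, Finset.sum_eq_zero, add_zero]
        · rfl
        intro a _
        rw [Prod.snd_sum, Finset.sum_eq_zero]
        intro b _
        split_ifs <;> rfl
    rw [hdecomp]
    refine add_mem hcart (sum_mem fun p _ => add_mem ?_ (sum_mem fun a _ => sum_mem fun b _ => ?_))
    · by_cases hp : ∃ a, (x.1 a a).coeff p ≠ 0
      · obtain ⟨a, ha⟩ := hp
        exact hroot (hxf a a p ha) (diagonalLayer_mem_rootSpace hx p a)
      · push Not at hp
        have : diagonalLayer x.1 p = 0 := by simp [diagonalLayer, hp]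
        rw [this]
        exact zero_mem W
    · split_ifs with hab
      · exact zero_mem W
      · by_cases hp : (x.1 a b).coeff p = 0
        · rw [hp, AddMonoidAlgebra.single_zero, Matrix.single_zero]
          exact zero_mem W
        · exact hroot (hxf a b p hp) (single_mem_rootSpace hab p _)

end HeightBorel

/-! ## Height functions of the extended Borel subalgebras -/

section ShuffleHeight

variable {n m : ℕ}

/-- The permutation of the indices that relates the weights of `𝔤°(r)` to those of `𝔤°`. -/
def localPerm (n m : ℕ) (r : ℤ) : Idx n m ≃ Idx n m :=
  Equiv.sumCongr (finRotate n ^ (-r)) (Equiv.refl _)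

/-- The multiple of `δ̄` that is subtracted in the weights of `𝔤°(r)`. -/
def localShift (r : ℤ) : Idx n m → ℤ
  | Sum.inl i => (i.val - r) / (n : ℤ)
  | Sum.inr _ => 0

/-- The position of an index in a shuffle. -/
def Shuffle.pos (σ : Shuffle n m) (a : Idx n m) : ℤ := (σ.toEquiv.symm a).val

theorem Shuffle.pos_nonneg (σ : Shuffle n m) (a : Idx n m) : 0 ≤ σ.pos a := Int.natCast_nonneg _

theorem Shuffle.pos_lt (σ : Shuffle n m) (a : Idx n m) : σ.pos a < (n : ℤ) + m := by
  have := (σ.toEquiv.symm a).isLt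
  simp only [Shuffle.pos]
  omega

/-- The height function of the extension of `𝔟°(σ, r)`. -/
def shuffleHeight (σ : Shuffle n m) (r : ℤ) (c : Idx n m) : ℤ :=
  σ.pos ((localPerm n m r).symm c) - localShift r ((localPerm n m r).symm c) * ((n : ℤ) + m)

theorem localEps_eq {k : Type*} [Field k] (r : ℤ) (a : Idx n m) :
    localEps k r a = eps (localPerm n m r a) - localShift r a • deltaBar k n m := by
  rcases a with i | j
  · rfl
  · simp [localEps, localPerm, localShift]

variable [NeZero n]

/-- The positions in a shuffle are the residues `0, …, n + m - 1`. Passing to `𝔤°(r)` permutes the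
indices and adds multiples of `n + m`. -/
theorem isAffineOrder_shuffleHeight (σ : Shuffle n m) (r : ℤ) :
    IsAffineOrder (shuffleHeight σ r) := by
  have hN : 0 < (n : ℤ) + m := by have := NeZero.pos n; omega
  constructor
  · intro a b p h
    set a' := (localPerm n m r).symm a with ha
    set b' := (localPerm n m r).symm b with hb
    have h1 := σ.pos_nonneg a'
    have h2 := σ.pos_lt a'
    have h3 := σ.pos_nonneg b'
    have h4 := σ.pos_lt b'
    have h5 : σ.pos a' = σ.pos b' + (localShift r a' - localShift r b' + p) * ((n : ℤ) + m) := by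
      simp only [affHeight, shuffleHeight, ← ha, ← hb] at h
      linarith
    have h6 : σ.pos a' = σ.pos b' := by
      rw [← Int.emod_eq_of_lt h1 h2, h5, Int.add_mul_emod_self_right, Int.emod_eq_of_lt h3 h4]
    have h7 : σ.toEquiv.symm a' = σ.toEquiv.symm b' := Fin.ext (Nat.cast_injective (R := ℤ) h6)
    exact (localPerm n m r).symm.injective (σ.toEquiv.symm.injective h7)
  · intro x
    have h1 := Int.emod_nonneg x hN.ne'
    have h2 := Int.emod_lt_of_pos x hN
    let a := σ.toEquiv ⟨(x % ((n : ℤ) + m)).toNat, by omega⟩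
    refine ⟨localPerm n m r a, x / ((n : ℤ) + m) + localShift r a, ?_⟩
    have h3 : σ.pos a = x % ((n : ℤ) + m) := by
      simp only [Shuffle.pos, a, Equiv.symm_apply_apply]
      exact Int.toNat_of_nonneg h1
    have h4 := Int.emod_add_mul_ediv x ((n : ℤ) + m)
    simp only [shuffleHeight, Equiv.symm_apply_apply, h3]
    linarith

noncomputable section

variable {k : Type*} [Field k]

/-- The weight `η_x`, where `η_0, …, η_{n+m-1}` are the weights of `𝔤°(r)` in the order of the
shuffle, and `η_{x+n+m} = η_x - δ̄`. -/
def etaWeight (k : Type*) [Field k] (σ : Shuffle n m) (r x : ℤ) :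
    Module.Dual k (cartan k n m) :=
  localEps k r (σ.toEquiv ⟨(x % ((n : ℤ) + m)).toNat, by
    have hN : 0 < (n : ℤ) + m := by have := NeZero.pos n; omega
    have h1 := Int.emod_nonneg x hN.ne'
    have h2 := Int.emod_lt_of_pos x hN
    omega⟩) - (x / ((n : ℤ) + m)) • deltaBar k n m

theorem etaWeight_natCast (σ : Shuffle n m) (r : ℤ) (i : Fin (n + m)) :
    etaWeight k σ r i = localEps k r (σ.toEquiv i) := by
  have h1 : (i : ℤ) % ((n : ℤ) + m) = i := Int.emod_eq_of_lt (by omega) (by omega)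
  have h2 : (i : ℤ) / ((n : ℤ) + m) = 0 := Int.ediv_eq_zero_of_lt (by omega) (by omega)
  simp only [etaWeight, h1, h2, zero_smul, sub_zero]
  rfl

theorem etaWeight_add_mul (σ : Shuffle n m) (r x t : ℤ) :
    etaWeight k σ r (x + t * ((n : ℤ) + m)) = etaWeight k σ r x - t • deltaBar k n m := by
  have hN : (n : ℤ) + m ≠ 0 := by have := NeZero.pos n; omega
  simp only [etaWeight, Int.add_mul_emod_self_right, Int.add_mul_ediv_right _ _ hN, add_smul]
  abel

/-- The height function locates each weight in the periodic chain, so a root is the difference of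
two chain members whose distance is its height. -/
theorem etaWeight_shuffleHeight (σ : Shuffle n m) (r : ℤ) (c : Idx n m) (t : ℤ) :
    etaWeight k σ r (shuffleHeight σ r c + t * ((n : ℤ) + m)) =
      eps c - t • deltaBar k n m := by
  obtain ⟨a, rfl⟩ := (localPerm n m r).surjective c
  rw [etaWeight_add_mul, shuffleHeight, Equiv.symm_apply_apply,
    sub_eq_add_neg (Shuffle.pos _ _), ← neg_mul, etaWeight_add_mul, Shuffle.pos, etaWeight_natCast, Equiv.apply_symm_apply, localEps_eq]
  simp

theorem affRoot_eq_etaWeight_sub (σ : Shuffle n m) (r : ℤ) (a b : Idx n m) (p : ℤ) :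
    affRoot k a b p = etaWeight k σ r (shuffleHeight σ r a) -
      etaWeight k σ r (shuffleHeight σ r a + affHeight (shuffleHeight σ r) a b p) := by
  have h1 := etaWeight_shuffleHeight (k := k) σ r a 0
  have h2 := etaWeight_shuffleHeight (k := k) σ r b p
  have e : shuffleHeight σ r a + affHeight (shuffleHeight σ r) a b p =
      shuffleHeight σ r b + p * ((n : ℤ) + m) := by simp only [affHeight]; ring
  rw [zero_mul, add_zero, zero_smul, sub_zero] at h1
  rw [e, h1, h2, affRoot]
  abel

theorem simpleRoot_eq (σ : Shuffle n m) (r : ℤ) (i : Fin (n + m - 1)) :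
    simpleRoot k σ r i = etaWeight k σ r i - etaWeight k σ r ((i : ℤ) + 1) := by
  have h1 := etaWeight_natCast (k := k) σ r ⟨i.val, by omega⟩
  have h2 := etaWeight_natCast (k := k) σ r ⟨i.val + 1, by omega⟩
  push_cast at h1 h2
  rw [simpleRoot, ← h1, ← h2]

theorem extendingRoot_eq (σ : Shuffle n m) (r : ℤ) :
    extendingRoot k σ r = etaWeight k σ r ((n : ℤ) + m - 1) - etaWeight k σ r ((n : ℤ) + m) := by
  have h1 : ∑ i, simpleRoot k σ r i = etaWeight k σ r 0 - etaWeight k σ r ((n : ℤ) + m - 1) := by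
    simp only [simpleRoot_eq]
    have := Finset.sum_range_sub' (fun i : ℕ => etaWeight k σ r i) (n + m - 1)
    rw [Finset.sum_range] at this
    push_cast at this
    rw [this]
    congr 2
    have := NeZero.pos n
    omega
  have h2 := etaWeight_add_mul (k := k) σ r 0 1
  rw [zero_add, one_mul, one_smul] at h2
  rw [extendingRoot, h1, h2]
  abel

/-- By periodicity `x` may be reduced modulo `n + m`. The extending root is the step across the end
of a period. -/
theorem etaWeight_sub_mem (σ : Shuffle n m) (r x : ℤ) :
    etaWeight k σ r x - etaWeight k σ r (x + 1) ∈
      insert (extendingRoot k σ r) (Set.range (simpleRoot k σ r)) := by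
  have hN : 0 < (n : ℤ) + m := by have := NeZero.pos n; omega
  have h1 := Int.emod_nonneg x hN.ne'
  have h2 := Int.emod_lt_of_pos x hN
  have h3 : x = x % ((n : ℤ) + m) + (x / ((n : ℤ) + m)) * ((n : ℤ) + m) := by
    rw [mul_comm]; exact (Int.emod_add_mul_ediv x _).symm
  have h4 : etaWeight k σ r x - etaWeight k σ r (x + 1) =
      etaWeight k σ r (x % ((n : ℤ) + m)) - etaWeight k σ r (x % ((n : ℤ) + m) + 1) := by
    conv_lhs => rw [h3, add_right_comm, etaWeight_add_mul, etaWeight_add_mul]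
    abel
  rw [h4]
  by_cases h : x % ((n : ℤ) + m) = (n : ℤ) + m - 1
  · left
    rw [extendingRoot_eq, h, sub_add_cancel]
  · right
    refine ⟨⟨(x % ((n : ℤ) + m)).toNat, by omega⟩, ?_⟩
    rw [simpleRoot_eq]
    simp only [Int.toNat_of_nonneg h1]

theorem exists_affRoot_eq (σ : Shuffle n m) (r x : ℤ) :
    ∃ a b p, etaWeight k σ r x - etaWeight k σ r (x + 1) = affRoot k a b p ∧
      affHeight (shuffleHeight σ r) a b p = 1 := by
  obtain ⟨a, s, ha⟩ := (isAffineOrder_shuffleHeight σ r).surj x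
  obtain ⟨b, t, hb⟩ := (isAffineOrder_shuffleHeight σ r).surj (x + 1)
  refine ⟨a, b, t - s, ?_, ?_⟩
  · rw [← ha, etaWeight_shuffleHeight, ha, ← hb, etaWeight_shuffleHeight, affRoot, sub_smul]
    abel
  · simp only [affHeight]
    linarith

/-- Simple roots are the steps of the chain and have height one; a root of height `d ≥ 0` telescopes
into `d` of them. -/
theorem extendedBorel_eq_heightBorel [CharZero k] (σ : Shuffle n m) (r : ℤ) :
    extendedBorel k σ r = heightBorel k (shuffleHeight σ r) := by
  apply borelOf_eq_heightBorel
  · have key (x : ℤ) : ∃ a b p, etaWeight k σ r x - etaWeight k σ r (x + 1) = affRoot k a b p ∧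
        0 ≤ affHeight (shuffleHeight σ r) a b p := by
      obtain ⟨a, b, p, h, h'⟩ := exists_affRoot_eq (k := k) σ r x
      exact ⟨a, b, p, h, by omega⟩
    rintro β (rfl | ⟨i, rfl⟩)
    · have := key ((n : ℤ) + m - 1)
      rwa [sub_add_cancel, ← extendingRoot_eq] at this
    · rw [simpleRoot_eq]
      exact key i
  · intro a b p h
    rw [affRoot_eq_etaWeight_sub σ r]
    obtain ⟨d, hd⟩ := Int.eq_ofNat_of_zero_le h
    rw [hd]
    generalize shuffleHeight σ r a = x
    clear hd h
    induction d with
    | zero => simp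
    | succ d ih =>
      have := add_mem ih (AddSubmonoid.subset_closure (etaWeight_sub_mem (k := k) σ r (x + d)))
      rw [sub_add_sub_cancel] at this
      push_cast
      rwa [← add_assoc]

end

end ShuffleHeight

/-! ## Young diagrams -/

section Rotation

variable {n : ℕ}

theorem val_finRotate_zpow (k : ℤ) (i : Fin n) :
    (((finRotate n ^ k) i).val : ℤ) = (i.val + k) % n := by
  obtain ⟨N, rfl⟩ : ∃ N, n = N + 1 := ⟨n - 1, by have := i.pos; omega⟩
  have hrot (y : Fin (N + 1)) : ((finRotate (N + 1) y).val : ℤ) = (y.val + 1) % (N + 1 : ℕ) := by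
    rw [finRotate_apply, Fin.val_add, Int.natCast_mod]
    push_cast
    rw [Fin.val_one', Int.natCast_mod]
    push_cast
    rw [Int.add_emod_emod]
  induction k with
  | zero => simpa using (Int.emod_eq_of_lt (by omega) (by omega : (i.val : ℤ) < N + 1)).symm
  | succ k ih =>
    rw [add_comm (k : ℤ), zpow_one_add, Equiv.Perm.mul_apply, hrot, ih, Int.emod_add_emod]
    congr 1; ring
  | pred k ih =>
    set y := (finRotate (N + 1) ^ (-(k : ℤ) - 1)) i with hy
    have e : (finRotate (N + 1) ^ (-(k : ℤ))) i = finRotate (N + 1) y := by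
      rw [hy, ← Equiv.Perm.mul_apply, ← zpow_one_add]
      congr 2; ring
    rw [e, hrot] at ih
    have h1 : ((y.val : ℤ) + 1 - 1) % (N + 1 : ℕ) = (i.val + -(k : ℤ) - 1) % (N + 1 : ℕ) :=
      Int.ModEq.sub_right 1 ih
    rw [add_sub_cancel_right, Int.emod_eq_of_lt (by omega) (by omega)] at h1
    rw [h1]
    congr 1; ring

/-- The quotient counts how often the rotation wraps around, and is the source of the periods in the
row levels. -/
theorem val_finRotate_zpow_add (k : ℤ) (i : Fin n) :
    (((finRotate n ^ k) i).val : ℤ) + n * ((i.val + k) / n) = i.val + k := by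
  rw [val_finRotate_zpow]
  exact Int.emod_add_mul_ediv _ _

end Rotation

theorem Nat.eq_of_forall_lt_iff {N a b : ℕ} (ha : a ≤ N) (hb : b ≤ N)
    (h : ∀ x < N, x < a ↔ x < b) : a = b := by
  by_contra hne
  rcases Nat.lt_or_gt_of_ne hne with h' | h'
  · have := h a (by omega); omega
  · have := h b (by omega); omega

/-- An initial segment that gains one point and stays an initial segment gains it at its end. This
is applied to the rows and to the columns of a diagram. -/
theorem Nat.eq_and_eq_of_forall_lt_iff {N a b c : ℕ} (hc : c < N) (ha : a ≤ N) (hcb : ¬c < b)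
    (h : ∀ x < N, x < a ↔ x = c ∨ x < b) : b = c ∧ a = c + 1 := by
  have h1 := h c hc
  constructor
  · by_contra hne
    have := h b (by omega)
    omega
  · by_contra hne
    have := h (c + 1) (by omega)
    omega

namespace Diagram

variable {n m : ℕ}

theorem conj_le (l : Diagram n m) (j : Fin m) : l.conj j ≤ n :=
  (Finset.card_filter_le _ _).trans (by simp)

/-- Since the parts decrease, the rows that reach column `j` form an initial segment, which is
therefore determined by its cardinality. -/
theorem lt_conj_iff (l : Diagram n m) (i : Fin n) (j : Fin m) :
    i.val < l.conj j ↔ j.val < l.part i := by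
  constructor
  · contrapose!
    intro h
    have : (Finset.univ.filter fun i' => j.val < l.part i') ⊆ Finset.Iio i := by
      intro i' hi'
      rw [Finset.mem_filter] at hi'
      rw [Finset.mem_Iio]
      by_contra hc
      have := l.anti (not_lt.1 hc)
      omega
    have := Finset.card_le_card this
    rw [Fin.card_Iio] at this
    exact this
  · intro h
    have : Finset.Iic i ⊆ (Finset.univ.filter fun i' => j.val < l.part i') := by
      intro i' hi'
      rw [Finset.mem_Iic] at hi'
      rw [Finset.mem_filter]
      have := l.anti hi'
      exact ⟨Finset.mem_univ _, by omega⟩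
    have := Finset.card_le_card this
    rw [Fin.card_Iic] at this
    exact this

theorem eq_of_conj_eq {l u : Diagram n m} (h : l.conj = u.conj) : l = u := by
  apply Diagram.ext
  funext i
  refine Nat.eq_of_forall_lt_iff (l.le i) (u.le i) fun x hx => ?_
  rw [← l.lt_conj_iff i ⟨x, hx⟩, h, u.lt_conj_iff]

/-- Adding the box in the row of `part i` and column `j`. -/
theorem addBox_iff {l u : Diagram n m} {i : Fin n} {j : Fin m} :
    AddBox (i.rev, j) l u ↔ ¬j.val < l.part i ∧
      ∀ i' (j' : Fin m), j'.val < u.part i' ↔ (i' = i ∧ j' = j) ∨ j'.val < l.part i' := by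
  refine and_congr (by simp [boxes]) ?_
  rw [Set.ext_iff]
  constructor
  · intro h i' j'
    have := h (i'.rev, j')
    simpa [boxes] using this
  · rintro h ⟨r, j'⟩
    have := h r.rev j'
    simpa [boxes, Fin.rev_eq_iff] using this

theorem AddBox.part_eq {l u : Diagram n m} {i : Fin n} {j : Fin m} (h : AddBox (i.rev, j) l u) :
    l.part i = j ∧ u.part i = j + 1 ∧ ∀ i', i' ≠ i → u.part i' = l.part i' := by
  rw [addBox_iff] at h
  obtain ⟨h1, h2⟩ := h
  have := Nat.eq_and_eq_of_forall_lt_iff (a := u.part i) (b := l.part i) j.isLt (u.le i) h1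
    fun x hx => by
      have := h2 i ⟨x, hx⟩
      simpa [Fin.ext_iff] using this
  refine ⟨this.1, this.2, fun i' hi' => ?_⟩
  refine Nat.eq_of_forall_lt_iff (u.le i') (l.le i') fun x hx => ?_
  simpa [hi'] using h2 i' ⟨x, hx⟩

theorem AddBox.conj_eq {l u : Diagram n m} {i : Fin n} {j : Fin m} (h : AddBox (i.rev, j) l u) :
    l.conj j = i ∧ u.conj j = i + 1 ∧ ∀ j', j' ≠ j → u.conj j' = l.conj j' := by
  rw [addBox_iff] at h
  obtain ⟨h1, h2⟩ := h
  simp only [← lt_conj_iff] at h1 h2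
  have := Nat.eq_and_eq_of_forall_lt_iff (a := u.conj j) (b := l.conj j) i.isLt (u.conj_le j) h1
    fun x hx => by
      have := h2 ⟨x, hx⟩ j
      simpa [Fin.ext_iff] using this
  refine ⟨this.1, this.2, fun j' hj' => ?_⟩
  refine Nat.eq_of_forall_lt_iff (u.conj_le j') (l.conj_le j') fun x hx => ?_
  simpa [hj'] using h2 ⟨x, hx⟩ j'

/-- The lengthened part stays below the preceding ones: any index smaller than `i`, the length of
column `j`, has a part exceeding `j`. -/
theorem exists_addBox {l : Diagram n m} {i : Fin n} {j : Fin m} (h1 : l.part i = j)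
    (h2 : l.conj j = i) : ∃ u, AddBox (i.rev, j) l u := by
  refine ⟨⟨Function.update l.part i (j + 1), fun a b hab => ?_, fun a => ?_⟩, ?_⟩
  · simp only [Function.update_apply]
    have := l.anti hab
    have h3 := l.lt_conj_iff a j
    split_ifs with hb ha ha
    · exact le_rfl
    · subst hb
      have : a.val < b.val := lt_of_le_of_ne hab fun h => ha (Fin.ext h)
      omega
    · subst ha
      omega
    · exact this
  · simp only [Function.update_apply]
    have := l.le a
    split_ifs <;> omega
  · rw [addBox_iff]
    refine ⟨by omega, fun i' j' => ?_⟩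
    simp only [Function.update_apply]
    split_ifs with h
    · subst h
      simp only [true_and, h1, Fin.ext_iff]
      omega
    · simp [h]

theorem exists_addBox' {u : Diagram n m} {i : Fin n} {j : Fin m} (h1 : u.part i = j + 1)
    (h2 : u.conj j = i + 1) : ∃ l, AddBox (i.rev, j) l u := by
  refine ⟨⟨Function.update u.part i j, fun a b hab => ?_, fun a => ?_⟩, ?_⟩
  · simp only [Function.update_apply]
    have := u.anti hab
    have h3 := u.lt_conj_iff b j
    split_ifs with hb ha ha
    · exact le_rfl
    · subst hb
      omega
    · subst ha
      have : a.val < b.val := lt_of_le_of_ne hab fun h => hb (Fin.ext h.symm)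
      omega
    · exact this
  · simp only [Function.update_apply]
    have := u.le a
    split_ifs <;> omega
  · rw [addBox_iff]
    refine ⟨by simp, fun i' j' => ?_⟩
    simp only [Function.update_apply]
    split_ifs with h
    · subst h
      simp only [true_and, h1, Fin.ext_iff]
      omega
    · simp [h]

theorem part_zero_eq [NeZero n] {l : Diagram n m} {j : Fin m} (hj : j.val + 1 = m)
    (h : 0 < l.conj j) : l.part 0 = m := by
  have h1 := (l.lt_conj_iff 0 j).1 (by simpa using h)
  have h2 := l.le 0
  omega

/-- `(m, λ_1, …, λ_{n-1})`. -/
def consRow (l : Diagram n m) : Diagram n m where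
  part i := if i.val = 0 then m else l.part ⟨i.val - 1, by omega⟩
  anti i i' h := by
    have h' : i.val ≤ i'.val := h
    dsimp only
    split_ifs
    · exact le_rfl
    · omega
    · exact l.le _
    · exact l.anti (Fin.mk_le_mk.2 (by omega))
  le i := by
    split_ifs
    · exact le_rfl
    · exact l.le _

theorem dropFirst_consRow {l : Diagram n m} (h : ∀ i : Fin n, i.val + 1 = n → l.part i = 0) :
    l.consRow.dropFirst = l := by
  apply Diagram.ext
  funext i
  simp only [dropFirst, consRow]
  split_ifs with h1 h2
  · exact h2.elim
  · rfl
  · exact (h i (by omega)).symm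

end Diagram

/-! ### Row and column levels of periodically extended diagrams -/

section Levels

variable {n m : ℕ}

/-- The `i`-th entry `s` of the periodically extended diagram: `x(λ, k) = (a | b)` has
`a_i = m (n - i) + n s`. -/
def rowLevel (p : Diagram n m × ℤ) (i : Fin n) : ℤ :=
  p.1.part ((finRotate n ^ p.2) i).rev + m * ((i.val + p.2) / n)

/-- The `j`-th column length `s` of the periodically extended diagram: `x(λ, k) = (a | b)` has
`b_j = n (j - 1) + m s`. -/
def colLevel (p : Diagram n m × ℤ) (j : Fin m) : ℤ := p.2 + p.1.conj j

theorem xPair_fst (p : Diagram n m × ℤ) (i : Fin n) :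
    (xPair p).1 i = m * (n - 1 - i) + n * rowLevel p i := by
  have := val_finRotate_zpow_add p.2 i
  simp only [xPair, nuPow, neg_neg, Prod.fst_add, Pi.add_apply, xDiagram, lambdaZero, rowLevel]
  linear_combination -(m : ℤ) * this

theorem xPair_snd (p : Diagram n m × ℤ) (j : Fin m) :
    (xPair p).2 j = n * j + m * colLevel p j := by
  simp only [xPair, nuPow, Prod.snd_add, Pi.add_apply, xDiagram, lambdaZero, colLevel]
  ring

theorem rotate_rev_val (p : Diagram n m × ℤ) (i : Fin n) :
    ((((finRotate n ^ p.2) i).rev.val : ℤ)) = n - 1 - i - p.2 + n * ((i.val + p.2) / n) := by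
  have h1 := val_finRotate_zpow_add p.2 i
  have h2 : ((((finRotate n ^ p.2) i).rev.val : ℤ)) = n - 1 - ((finRotate n ^ p.2) i).val := by
    rw [Fin.val_rev]; omega
  linarith

variable [NeZero n]

namespace YoungClass

/-- `rowLevel` on classes. -/
def row : YoungClass n m → Fin n → ℤ :=
  Quot.lift rowLevel fun p q h => by
    have hn : (n : ℤ) ≠ 0 := Int.natCast_ne_zero.2 (NeZero.ne n)
    -- The coordinates of `x` are already known to be invariant, and the levels are recovered from
    -- them by cancelling `n`.
    have hx : xPair p = xPair q := congrArg (xMap n m) (Quot.sound h)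
    funext i
    have h1 := xPair_fst p i
    rw [hx, xPair_fst] at h1
    exact (mul_left_cancel₀ hn (add_left_cancel h1)).symm

/-- `colLevel` on classes. -/
def col : YoungClass n m → Fin m → ℤ :=
  Quot.lift colLevel fun p q h => by
    funext j
    have hm : (m : ℤ) ≠ 0 := by have := j.pos; omega
    have hx : xPair p = xPair q := congrArg (xMap n m) (Quot.sound h)
    have h1 := xPair_snd p j
    rw [hx, xPair_snd] at h1
    exact (mul_left_cancel₀ hm (add_left_cancel h1)).symm

theorem xMap_fst (v : YoungClass n m) (i : Fin n) :
    (xMap n m v).1 i = m * (n - 1 - i) + n * v.row i := by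
  obtain ⟨p, rfl⟩ := Quot.exists_rep v
  exact xPair_fst p i

theorem xMap_snd (v : YoungClass n m) (j : Fin m) :
    (xMap n m v).2 j = n * j + m * v.col j := by
  obtain ⟨p, rfl⟩ := Quot.exists_rep v
  exact xPair_snd p j

theorem row_mk (l : Diagram n m) (k : ℤ) (i : Fin n) : (mk l k).row i = rowLevel (l, k) i := rfl

theorem col_mk (l : Diagram n m) (k : ℤ) (j : Fin m) : (mk l k).col j = k + l.conj j := rfl

theorem mk_dropFirst {l : Diagram n m} (h : l.part 0 = m) (k : ℤ) :
    mk l.dropFirst (k + 1) = mk l k :=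
  (Quot.sound (RowDeletion.mk l k h)).symm

theorem exists_mk (v : YoungClass n m) : ∃ l k, v = mk l k := by
  obtain ⟨⟨l, k⟩, rfl⟩ := Quot.exists_rep v
  exact ⟨l, k, rfl⟩

/-- For `d > 0` equality of levels forces the last column of `l` to be nonempty. Hence `λ_1 = m`,
and deleting that row reduces `d` by one. -/
theorem mk_eq_of_col_eq (hm : 0 < m) (d : ℕ) {l u : Diagram n m} {k : ℤ}
    (h : (mk l k).col = (mk u (k + d)).col) : mk l k = mk u (k + d) := by
  induction d generalizing l k with
  | zero =>
    have : l = u := Diagram.eq_of_conj_eq <| funext fun j => by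
      have := congrFun h j
      simp only [col_mk] at this
      omega
    subst this
    simp
  | succ d ih =>
    have h0 : l.part 0 = m := by
      refine Diagram.part_zero_eq (j := ⟨m - 1, by omega⟩) (by simp; omega) ?_
      have := congrFun h ⟨m - 1, by omega⟩
      simp only [col_mk] at this
      omega
    have e : k + (d + 1 : ℕ) = k + 1 + d := by push_cast; ring
    rw [e, ← mk_dropFirst h0] at h ⊢
    exact ih h

theorem col_injective (hm : 0 < m) : Function.Injective (col : YoungClass n m → Fin m → ℤ) := by
  intro v w h
  obtain ⟨l, k, rfl⟩ := v.exists_mk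
  obtain ⟨u, k', rfl⟩ := w.exists_mk
  rcases le_total k k' with hk | hk
  · obtain ⟨d, rfl⟩ := Int.le.dest hk
    exact mk_eq_of_col_eq hm d h
  · obtain ⟨d, rfl⟩ := Int.le.dest hk
    exact (mk_eq_of_col_eq hm d h.symm).symm

/-- `w` is obtained from `v` by adding the box that corresponds to `ε_i - δ_j`. -/
def AddArrow (i : Fin n) (j : Fin m) (v w : YoungClass n m) : Prop :=
  ∃ (k : ℤ) (l u : Diagram n m), Diagram.AddBox ((finRotate n ^ k) i, j) l u ∧
    v = mk l k ∧ w = mk u k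

theorem youngArrow_iff (α : IsoRoot n m) (v w : YoungClass n m) :
    YoungArrow α v w ↔ (α.sign = 1 ∧ AddArrow α.row α.col v w) ∨
      (α.sign = -1 ∧ AddArrow α.row α.col w v) := by
  constructor
  · rintro ⟨k, l, u, ⟨hs, h⟩ | ⟨hs, h⟩, rfl, rfl⟩
    · exact Or.inl ⟨hs, k, l, u, h, rfl, rfl⟩
    · exact Or.inr ⟨hs, k, u, l, h, rfl, rfl⟩
  · rintro (⟨hs, k, l, u, h, rfl, rfl⟩ | ⟨hs, k, u, l, h, rfl, rfl⟩)
    · exact ⟨k, l, u, Or.inl ⟨hs, h⟩, rfl, rfl⟩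
    · exact ⟨k, l, u, Or.inr ⟨hs, h⟩, rfl, rfl⟩

/-- The numerical form of the condition that the box of `ε_i - δ_j` is an outer corner (for
`e = 0`) or an inner corner (for `e = 1`). -/
def IsCorner (e : ℤ) (i : Fin n) (j : Fin m) (v : YoungClass n m) : Prop :=
  ∃ Q : ℤ, v.row i = j + e + m * Q ∧ v.col j = n - 1 - i + e + n * Q

theorem AddArrow.row_eq {i : Fin n} {j : Fin m} {v w : YoungClass n m} (h : AddArrow i j v w) :
    w.row i = v.row i + 1 ∧ ∀ i', i' ≠ i → w.row i' = v.row i' := by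
  obtain ⟨k, l, u, h, rfl, rfl⟩ := h
  rw [← Fin.rev_rev ((finRotate n ^ k) i)] at h
  obtain ⟨h1, h2, h3⟩ := h.part_eq
  simp only [row_mk, rowLevel]
  refine ⟨by rw [h1, h2]; push_cast; ring, fun i' hi' => ?_⟩
  rw [h3]
  intro e
  exact hi' ((finRotate n ^ k).injective (Fin.rev_injective e))

theorem AddArrow.col_eq {i : Fin n} {j : Fin m} {v w : YoungClass n m} (h : AddArrow i j v w) :
    w.col j = v.col j + 1 ∧ ∀ j', j' ≠ j → w.col j' = v.col j' := by
  obtain ⟨k, l, u, h, rfl, rfl⟩ := h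
  rw [← Fin.rev_rev ((finRotate n ^ k) i)] at h
  obtain ⟨h1, h2, h3⟩ := h.conj_eq
  simp only [col_mk]
  refine ⟨by rw [h1, h2]; push_cast; ring, fun j' hj' => by rw [h3 j' hj']⟩

theorem AddArrow.isCorner {i : Fin n} {j : Fin m} {v w : YoungClass n m} (h : AddArrow i j v w) :
    IsCorner 0 i j v := by
  obtain ⟨k, l, u, h, rfl, rfl⟩ := h
  rw [← Fin.rev_rev ((finRotate n ^ k) i)] at h
  refine ⟨(i.val + k) / n, ?_, ?_⟩
  · simp only [row_mk, rowLevel, h.part_eq.1, add_zero]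
  · have := rotate_rev_val (l, k) i
    simp only at this
    rw [col_mk, h.conj_eq.1, this]
    ring

theorem AddArrow.right_unique (hm : 0 < m) {i : Fin n} {j : Fin m} {v w w' : YoungClass n m}
    (h : AddArrow i j v w) (h' : AddArrow i j v w') : w = w' := by
  refine col_injective hm (funext fun j' => ?_)
  by_cases hj : j' = j
  · subst hj; rw [h.col_eq.1, h'.col_eq.1]
  · rw [h.col_eq.2 j' hj, h'.col_eq.2 j' hj]

theorem AddArrow.left_unique (hm : 0 < m) {i : Fin n} {j : Fin m} {v v' w : YoungClass n m}
    (h : AddArrow i j v w) (h' : AddArrow i j v' w) : v = v' := by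
  refine col_injective hm (funext fun j' => ?_)
  by_cases hj : j' = j
  · subst hj; have := h.col_eq.1; have := h'.col_eq.1; omega
  · rw [← h.col_eq.2 j' hj, ← h'.col_eq.2 j' hj]

theorem isActionRel_youngArrow (hm : 0 < m) :
    IsActionRel (YoungArrow : IsoRoot n m → YoungClass n m → YoungClass n m → Prop) where
  unique {α v w w'} h h' := by
    rw [youngArrow_iff] at h h'
    rcases h with ⟨hs, h⟩ | ⟨hs, h⟩ <;> rcases h' with ⟨hs', h'⟩ | ⟨hs', h'⟩
    · exact h.right_unique hm h'
    · simp [hs] at hs'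
    · simp [hs] at hs'
    · exact h.left_unique hm h'
  symm {α v w} h := by
    rw [youngArrow_iff] at h ⊢
    rcases h with ⟨hs, h⟩ | ⟨hs, h⟩
    · exact Or.inr ⟨by simp [hs], h⟩
    · exact Or.inl ⟨by simp [hs], h⟩

end YoungClass

end Levels

/-! ## Corners and the Sergeev-Veselov action -/

section Corners

variable {n m : ℕ}

theorem hasArrow_SV_iff (α : IsoRoot n m) (x y : SuperLattice n m) :
    HasArrow (SV n m) α x y ↔
      x.1 α.row - x.2 α.col = (if α.sign = 1 then 0 else (n : ℤ) - m) ∧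
        x + (α.sign : ℤ) • SuperLattice.vec (n : ℤ) m α.row α.col = y := by
  have hform : SuperLattice.form x (SuperLattice.vec 1 1 α.row α.col) =
      x.1 α.row - x.2 α.col := by
    simp [SuperLattice.form, SuperLattice.vec, Pi.single_apply]
  rw [← hform, ← SuperLattice.shift_neg α]
  exact ⟨fun ⟨h1, h2⟩ => ⟨h1, h2⟩, fun ⟨h1, h2⟩ => ⟨h1, h2⟩⟩

variable [NeZero n]

namespace YoungClass

/-- The corner condition in terms of a representative. -/
theorem exists_addArrow_mk {l : Diagram n m} {k : ℤ} {i : Fin n} {j : Fin m}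
    (h1 : l.part ((finRotate n ^ k) i).rev = j)
    (h2 : l.conj j = ((finRotate n ^ k) i).rev) : ∃ w, AddArrow i j (mk l k) w := by
  obtain ⟨u, hu⟩ := Diagram.exists_addBox h1 h2
  rw [Fin.rev_rev] at hu
  exact ⟨mk u k, k, l, u, hu, rfl, rfl⟩

theorem exists_addArrow_mk' {u : Diagram n m} {k : ℤ} {i : Fin n} {j : Fin m}
    (h1 : u.part ((finRotate n ^ k) i).rev = j + 1)
    (h2 : u.conj j = ((finRotate n ^ k) i).rev + 1) : ∃ v, AddArrow i j v (mk u k) := by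
  obtain ⟨l, hl⟩ := Diagram.exists_addBox' h1 h2
  rw [Fin.rev_rev] at hl
  exact ⟨mk l k, k, l, u, hl, rfl, rfl⟩

/-- When `Q` is the wrap count of the representative, the periods cancel and the condition becomes
that of a corner of the diagram itself. -/
theorem exists_addArrow_mk_of_isCorner {e : ℕ} {l : Diagram n m} {k : ℤ} {i : Fin n} {j : Fin m}
    {Q : ℤ} (hQ : (i.val + k) / (n : ℤ) = Q) (h1 : (mk l k).row i = j + e + m * Q)
    (h2 : (mk l k).col j = n - 1 - i + e + n * Q) :
    l.part ((finRotate n ^ k) i).rev = j + e ∧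
      l.conj j = ((finRotate n ^ k) i).rev + e := by
  have h3 := rotate_rev_val (l, k) i
  simp only [row_mk, col_mk, rowLevel, hQ] at h1 h2 h3
  constructor
  · omega
  · omega

theorem exists_addArrow_of_isCorner {i : Fin n} {j : Fin m} {v : YoungClass n m}
    (h : IsCorner 0 i j v) : ∃ w, AddArrow i j v w := by
  obtain ⟨Q, h1, h2⟩ := h
  obtain ⟨l, k, rfl⟩ := v.exists_mk
  by_cases hQ : (i.val + k) / (n : ℤ) = Q
  · have := exists_addArrow_mk_of_isCorner (e := 0) hQ (by simpa using h1) (by simpa using h2)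
    exact exists_addArrow_mk this.1 this.2
  · have h3 := rotate_rev_val (l, k) i
    have hrev := ((finRotate n ^ k) i).rev.isLt
    have hle := l.le ((finRotate n ^ k) i).rev
    have hc := l.conj_le j
    have hj := j.isLt
    have h1' := h1
    have h2' := h2
    simp only [row_mk, col_mk, rowLevel] at h1' h2' h3
    obtain ⟨s, hs⟩ : ∃ s, Q = (i.val + k) / (n : ℤ) + s :=
      ⟨Q - (i.val + k) / (n : ℤ), by ring⟩
    -- Otherwise the box lies one period further. The bounds on parts and columns then leave only a
    -- full row `λ_1 = m`, whose deletion brings the box into the rectangle.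
    have hs1 : s = 1 := by
      have e1 : (m : ℤ) * s = l.part ((finRotate n ^ k) i).rev - j := by
        rw [hs] at h1'; linarith
      have hm : (0 : ℤ) < m := by omega
      have : s ≤ 1 := by
        by_contra hc
        nlinarith
      have : -1 < s := by
        by_contra hc
        nlinarith
      omega
    subst hs1
    rw [hs, mul_add, mul_one] at h1' h2'
    have hrev0 : ((finRotate n ^ k) i).rev.val = 0 := by omega
    have hconj : l.conj j = n := by omega
    have hpart : l.part ((finRotate n ^ k) i).rev = m := by omega
    have h0 : l.part 0 = m := by
      have : ((finRotate n ^ k) i).rev = 0 := Fin.ext (by simpa using hrev0)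
      rwa [this] at hpart
    have hQ' : (i.val + (k + 1)) / (n : ℤ) = Q := by
      have hn : (n : ℤ) ≠ 0 := by have := NeZero.ne n; omega
      have : (i.val : ℤ) + (k + 1) = n * Q := by rw [hs, mul_add]; linarith
      rw [this, Int.mul_ediv_cancel_left _ hn]
    rw [← mk_dropFirst h0] at h1 h2 ⊢
    have := exists_addArrow_mk_of_isCorner (e := 0) hQ' (by simpa using h1) (by simpa using h2)
    exact exists_addArrow_mk this.1 this.2

theorem exists_addArrow_of_isCorner' {i : Fin n} {j : Fin m} {w : YoungClass n m}
    (h : IsCorner 1 i j w) : ∃ v, AddArrow i j v w := by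
  obtain ⟨Q, h1, h2⟩ := h
  obtain ⟨l, k, rfl⟩ := w.exists_mk
  by_cases hQ : (i.val + k) / (n : ℤ) = Q
  · have := exists_addArrow_mk_of_isCorner (e := 1) hQ (by simpa using h1) (by simpa using h2)
    exact exists_addArrow_mk' this.1 this.2
  · have h3 := rotate_rev_val (l, k) i
    have hrev := ((finRotate n ^ k) i).rev.isLt
    have hle := l.le ((finRotate n ^ k) i).rev
    have hc := l.conj_le j
    have hj := j.isLt
    have h1' := h1
    have h2' := h2
    simp only [row_mk, col_mk, rowLevel] at h1' h2' h3
    obtain ⟨s, hs⟩ : ∃ s, Q = (i.val + k) / (n : ℤ) + s :=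
      ⟨Q - (i.val + k) / (n : ℤ), by ring⟩
    -- Dually, the box lies one period back, which forces `λ_n = 0`. Prepending a full row and
    -- lowering `k` gives a representative containing the box.
    have hs1 : s = -1 := by
      have e1 : (m : ℤ) * s = l.part ((finRotate n ^ k) i).rev - j - 1 := by
        rw [hs] at h1'; linarith
      have hm : (0 : ℤ) < m := by omega
      have : s < 1 := by
        by_contra hc
        nlinarith
      have : -1 ≤ s := by
        by_contra hc
        nlinarith
      omega
    subst hs1
    rw [hs, mul_add, mul_neg_one] at h1' h2'
    have hrev0 : ((finRotate n ^ k) i).rev.val + 1 = n := by omega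
    have hconj : l.conj j = 0 := by omega
    have hpart : l.part ((finRotate n ^ k) i).rev = 0 := by omega
    have hlast : ∀ i' : Fin n, i'.val + 1 = n → l.part i' = 0 := by
      intro i' hi'
      have : i' = ((finRotate n ^ k) i).rev := Fin.ext (by omega)
      rwa [this]
    have hk : mk l.consRow (k - 1) = mk l k := by
      have := mk_dropFirst (l := l.consRow) (by simp [Diagram.consRow]) (k - 1)
      rwa [Diagram.dropFirst_consRow hlast, sub_add_cancel, eq_comm] at this
    have hQ' : (i.val + (k - 1)) / (n : ℤ) = Q := by
      have hn : (n : ℤ) ≠ 0 := by have := NeZero.ne n; omega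
      have : (i.val : ℤ) + (k - 1) = (n - 1) + n * Q := by
        have h4 : (((finRotate n ^ k) i).rev.val : ℤ) + 1 = n := by exact_mod_cast hrev0
        rw [hs, mul_add]
        linarith
      rw [this, Int.add_mul_ediv_left _ _ hn, Int.ediv_eq_zero_of_lt (by omega) (by omega),
        zero_add]
    rw [← hk] at h1 h2 ⊢
    have := exists_addArrow_mk_of_isCorner (e := 1) hQ' (by simpa using h1) (by simpa using h2)
    exact exists_addArrow_mk' this.1 this.2

/-- If the positions of the row `i` and of the column `j` are adjacent up to the period, in this
order for `e = 0` and in the opposite order for `e = 1`, then there is a corner. -/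
theorem isCorner_of_adjacent {e : ℤ} (he : e = 0 ∨ e = 1) {i : Fin n} {j : Fin m}
    {v : YoungClass n m} {p : ℤ}
    (h : v.row i - j - e + (v.col j - (n - 1 - i) - e) = p * ((n : ℤ) + m)) :
    IsCorner e i j v := by
  obtain ⟨l, k, rfl⟩ := v.exists_mk
  have h3 := rotate_rev_val (l, k) i
  have hlt := l.lt_conj_iff ((finRotate n ^ k) i).rev j
  have hrev := ((finRotate n ^ k) i).rev.isLt
  have hle := l.le ((finRotate n ^ k) i).rev
  have hc := l.conj_le j
  have hj := j.isLt
  simp only [IsCorner, row_mk, col_mk, rowLevel] at h h3 ⊢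
  set Q := (i.val + k) / (n : ℤ)
  set a := ((finRotate n ^ k) i).rev.val
  set b := l.part ((finRotate n ^ k) i).rev
  set c := l.conj j
  have h4 : ((b : ℤ) - j - e) + ((c : ℤ) - a - e) = (p - Q) * ((n : ℤ) + m) := by
    linear_combination h - h3
  refine ⟨p, ?_⟩
  obtain ⟨s, rfl⟩ : ∃ s, p = Q + s := ⟨p - Q, by ring⟩
  rw [add_sub_cancel_left] at h4
  have hN : 0 < (n : ℤ) + m := by omega
  rw [mul_add, mul_add]
  -- Both summands of `h4` are bounded by the rectangle, the first by `m` and the second by `n` in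
  -- absolute value. The upper bounds can be attained only for `e = 0`, the lower ones only for `e =
  -- 1`.
  have hs : s = 0 ∨ (s = 1 ∧ e = 0) ∨ (s = -1 ∧ e = 1) := by
    have hlow : -((n : ℤ) + m) ≤ s * ((n : ℤ) + m) := by
      rw [← h4]; rcases he with rfl | rfl <;> omega
    have hupp : s * ((n : ℤ) + m) ≤ (n : ℤ) + m := by
      rw [← h4]; rcases he with rfl | rfl <;> omega
    have h5 : -1 ≤ s := by
      by_contra hc
      nlinarith
    have h6 : s ≤ 1 := by
      by_contra hc
      nlinarith
    have : s = -1 ∨ s = 0 ∨ s = 1 := by omega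
    rcases this with rfl | rfl | rfl <;> omega
  -- For `s = 0`, `hlt` rules out summands of opposite signs, so both vanish. For `s = ±1` both must
  -- be extreme.
  rcases hs with rfl | ⟨rfl, rfl⟩ | ⟨rfl, rfl⟩
  · constructor <;> omega
  · constructor <;> omega
  · constructor <;> omega

/-- The hyperplane equation reads `n A = m C`, where `A` and `C` are the row and column defects. By
coprimality `A = m Q`, and then `C = n Q`. -/
theorem isCorner_of_coprime (hnm : n.Coprime m) {e : ℤ} {i : Fin n} {j : Fin m}
    {v : YoungClass n m}
    (h : (xMap n m v).1 i - (xMap n m v).2 j = e * (n - m)) : IsCorner e i j v := by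
  have hm : (m : ℤ) ≠ 0 := by have := j.pos; omega
  rw [xMap_fst, xMap_snd] at h
  have h1 : (n : ℤ) * (v.row i - j - e) = m * (v.col j - (n - 1 - i) - e) := by
    linear_combination h
  have hco : IsCoprime (m : ℤ) n := (Nat.isCoprime_iff_coprime.2 hnm).symm
  obtain ⟨Q, hQ⟩ := hco.dvd_of_dvd_mul_left (Dvd.intro _ h1.symm)
  refine ⟨Q, by linarith, ?_⟩
  rw [hQ, mul_left_comm] at h1
  have := mul_left_cancel₀ hm h1
  linarith

theorem IsCorner.xMap_sub {e : ℤ} {i : Fin n} {j : Fin m} {v : YoungClass n m}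
    (h : IsCorner e i j v) : (xMap n m v).1 i - (xMap n m v).2 j = e * (n - m) := by
  obtain ⟨Q, h1, h2⟩ := h
  rw [xMap_fst, xMap_snd, h1, h2]
  ring

theorem xMap_injective (hm : 0 < m) : Function.Injective (xMap n m) := by
  intro v w h
  refine col_injective hm (funext fun j => ?_)
  have := xMap_snd v j
  rw [h, xMap_snd] at this
  have hm' : (m : ℤ) ≠ 0 := by omega
  exact (mul_left_cancel₀ hm' (add_left_cancel this)).symm

theorem AddArrow.xMap_eq {i : Fin n} {j : Fin m} {v w : YoungClass n m} (h : AddArrow i j v w) :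
    xMap n m w = xMap n m v + SuperLattice.vec (n : ℤ) m i j := by
  refine Prod.ext (funext fun i' => ?_) (funext fun j' => ?_)
  · simp only [Prod.fst_add, Pi.add_apply, xMap_fst, SuperLattice.vec, Pi.single_apply]
    split_ifs with hi
    · subst hi; rw [h.row_eq.1]; ring
    · rw [h.row_eq.2 i' hi, add_zero]
  · simp only [Prod.snd_add, Pi.add_apply, xMap_snd, SuperLattice.vec, Pi.single_apply]
    split_ifs with hj
    · subst hj; rw [h.col_eq.1]; ring
    · rw [h.col_eq.2 j' hj, add_zero]

theorem AddArrow.isCorner' {i : Fin n} {j : Fin m} {v w : YoungClass n m} (h : AddArrow i j v w) :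
    IsCorner 1 i j w := by
  obtain ⟨Q, h1, h2⟩ := h.isCorner
  exact ⟨Q, by rw [h.row_eq.1, h1]; ring, by rw [h.col_eq.1, h2]; ring⟩

end YoungClass

theorem hasArrow_SV_of_youngArrow (α : IsoRoot n m) {v w : YoungClass n m}
    (h : YoungArrow α v w) : HasArrow (SV n m) α (xMap n m v) (xMap n m w) := by
  rw [YoungClass.youngArrow_iff] at h
  rw [hasArrow_SV_iff]
  rcases h with ⟨hs, h⟩ | ⟨hs, h⟩
  · rw [hs, h.xMap_eq, h.isCorner.xMap_sub]
    simp
  · rw [hs, h.isCorner'.xMap_sub, h.xMap_eq]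
    simp

theorem exists_youngArrow_of_hasArrow_SV (hnm : n.Coprime m) (α : IsoRoot n m)
    {v : YoungClass n m} {y : SuperLattice n m} (h : HasArrow (SV n m) α (xMap n m v) y) :
    ∃ w, YoungArrow α v w := by
  simp only [YoungClass.youngArrow_iff]
  rw [hasArrow_SV_iff] at h
  rcases Int.units_eq_one_or α.sign with hs | hs
  · obtain ⟨w, hw⟩ := YoungClass.exists_addArrow_of_isCorner
      (YoungClass.isCorner_of_coprime (e := 0) hnm (by simpa [hs] using h.1))
    exact ⟨w, Or.inl ⟨hs, hw⟩⟩
  · obtain ⟨w, hw⟩ := YoungClass.exists_addArrow_of_isCorner'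
      (YoungClass.isCorner_of_coprime (e := 1) hnm (by simpa [hs] using h.1))
    exact ⟨w, Or.inr ⟨hs, hw⟩⟩

theorem xMap_mk_empty : xMap n m (YoungClass.mk (Diagram.empty n m) 0) = lambdaZero n m := by
  refine Prod.ext (funext fun i => ?_) (funext fun j => ?_)
  · change (xPair _).1 i = _
    simp [xPair, nuPow, xDiagram, Diagram.empty]
  · change (xPair _).2 j = _
    simp [xPair, nuPow, xDiagram, Diagram.empty, Diagram.conj]

end Corners

/-! ## The Borel subalgebra of a Young diagram -/

namespace Diagram

variable {n m : ℕ} (l : Diagram n m)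

theorem conj_antitone : Antitone l.conj := fun j j' h =>
  Finset.card_le_card fun i hi => by
    have h' : j.val ≤ j'.val := h
    simp only [Finset.mem_filter, Finset.mem_univ, true_and] at hi ⊢
    omega

/-- The position of an index in the boundary path of `l`. -/
def position : Idx n m → Fin (n + m)
  | Sum.inl i => ⟨i.val + l.part i.rev, by have := l.le i.rev; omega⟩
  | Sum.inr j => ⟨j.val + n - l.conj j, by omega⟩

theorem position_strictMono_inl : StrictMono fun i : Fin n => l.position (Sum.inl i) := by
  intro i i' h
  have h1 : i.val < i'.val := h
  have h2 := l.anti (Fin.rev_le_rev.2 h.le)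
  change i.val + l.part i.rev < i'.val + l.part i'.rev
  omega

theorem position_strictMono_inr : StrictMono fun j : Fin m => l.position (Sum.inr j) := by
  intro j j' h
  have h1 : j.val < j'.val := h
  have h2 := l.conj_antitone h.le
  have h3 := l.conj_le j
  change j.val + n - l.conj j < j'.val + n - l.conj j'
  omega

/-- On the boundary path, the step of row `i` comes after that of column `j` if the box `(i, j)`
lies in the diagram, and before it otherwise. -/
theorem position_inl_ne_inr (i : Fin n) (j : Fin m) :
    l.position (Sum.inl i) ≠ l.position (Sum.inr j) := by
  intro h
  have h1 : i.val + l.part i.rev = j.val + n - l.conj j := congrArg Fin.val h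
  have h2 := l.lt_conj_iff i.rev j
  have h3 := l.conj_le j
  rw [Fin.val_rev] at h2
  omega

theorem position_bijective : Function.Bijective l.position := by
  refine (Fintype.bijective_iff_injective_and_card _).2 ⟨?_, by simp⟩
  rintro (i | j) (i' | j') h
  · exact congrArg _ (l.position_strictMono_inl.injective h)
  · exact absurd h (l.position_inl_ne_inr i j')
  · exact absurd h.symm (l.position_inl_ne_inr i' j)
  · exact congrArg _ (l.position_strictMono_inr.injective h)

/-- The shuffle given by the boundary path of `l`. -/
noncomputable def shuffle : Shuffle n m where
  toEquiv := (Equiv.ofBijective _ l.position_bijective).symm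
  left_mono := l.position_strictMono_inl
  right_mono := l.position_strictMono_inr

theorem shuffle_pos (a : Idx n m) : l.shuffle.pos a = (l.position a).val := rfl

theorem sum_part_eq_sum_conj : ∑ i, l.part i = ∑ j, l.conj j := by
  have h (i : Fin n) : l.part i = ∑ j : Fin m, if j.val < l.part i then 1 else 0 := by
    rw [← Finset.card_filter, Fin.card_filter_val_lt, min_eq_right (l.le i)]
  simp only [conj, Finset.card_filter]
  rw [Finset.sum_comm]
  exact Finset.sum_congr rfl fun i _ => h i

end Diagram

/-! ### Height functions of classes of Young diagrams -/

section YoungHeight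

variable {n m : ℕ}

theorem IsAffineOrder.of_sub_eq {f g : Idx n m → ℤ} (hf : IsAffineOrder f) (c : ℤ)
    (h : ∀ a, f a = g a + c) : IsAffineOrder g := by
  constructor
  · intro a b p hp
    refine hf.inj (p := p) ?_
    simp only [affHeight, h] at hp ⊢
    linarith
  · intro x
    obtain ⟨a, t, ha⟩ := hf.surj (x + c)
    exact ⟨a, t, by rw [h] at ha; linarith⟩

theorem IsHeightReflection.symm {f g : Idx n m → ℤ} (hf : IsAffineOrder f) {a b : Idx n m}
    (hab : a ≠ b) {p : ℤ} (h : IsHeightReflection f g a b p) :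
    IsHeightReflection g f b a (-p) := by
  obtain ⟨h0, h⟩ := h
  refine ⟨(h b a (-p) hab.symm).2 (Or.inl ⟨rfl, rfl, rfl⟩), fun c d q hcd => ?_⟩
  have h1 := h c d q hcd
  have h2 := hf.ne_zero hab p
  rw [neg_neg]
  by_cases hpos : c = a ∧ d = b ∧ q = p
  · obtain ⟨rfl, rfl, rfl⟩ := hpos
    simp [h0]
  · by_cases hneg : c = b ∧ d = a ∧ q = -p
    · obtain ⟨rfl, rfl, rfl⟩ := hneg
      rw [affHeight_neg]
      simp only [hpos, false_or, and_self, not_true_eq_false, false_and, iff_false]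
      omega
    · rw [h1]
      simp only [hpos, hneg, false_or, not_false_eq_true, true_and]

variable [NeZero n]

/-- The height function of the Borel subalgebra that corresponds to a class of diagrams. -/
def YoungClass.height (v : YoungClass n m) : Idx n m → ℤ
  | Sum.inl i => i.val + v.row i
  | Sum.inr j => n + j.val - v.col j

/-- The constant `k` is harmless, as roots see only differences. Dropping it gives a function that
is well defined on classes. -/
theorem shuffleHeight_shuffle (l : Diagram n m) (k : ℤ) (a : Idx n m) :
    shuffleHeight l.shuffle k a = (YoungClass.mk l k).height a + k := by
  rcases a with i | j
  · have e : (localPerm n m k).symm (Sum.inl i) = Sum.inl ((finRotate n ^ k) i) := by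
      rw [Equiv.symm_apply_eq]
      change Sum.inl i = Sum.inl ((finRotate n ^ (-k)) ((finRotate n ^ k) i))
      exact congrArg _ (by rw [zpow_neg]; exact (Equiv.symm_apply_apply (finRotate n ^ k) i).symm)
    have h1 := val_finRotate_zpow_add k i
    have h2 : localShift (n := n) (m := m) k (Sum.inl ((finRotate n ^ k) i)) =
        -((i.val + k) / (n : ℤ)) := by
      have hn : (n : ℤ) ≠ 0 := by have := NeZero.ne n; omega
      have : (((finRotate n ^ k) i).val : ℤ) - k = i.val + n * (-((i.val + k) / (n : ℤ))) := by
        linarith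
      rw [localShift, this, Int.add_mul_ediv_left _ _ hn,
        Int.ediv_eq_zero_of_lt (by omega) (by omega), zero_add]
    have h3 : l.shuffle.pos (Sum.inl ((finRotate n ^ k) i)) =
        ((finRotate n ^ k) i).val + l.part ((finRotate n ^ k) i).rev := by
      rw [Diagram.shuffle_pos]
      simp [Diagram.position]
    simp only [shuffleHeight, e, h2, h3, YoungClass.height, YoungClass.row_mk, rowLevel]
    linear_combination h1
  · have e : (localPerm n m k).symm (Sum.inr j) = Sum.inr j := rfl
    have h3 : l.shuffle.pos (Sum.inr j) = j.val + n - l.conj j := by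
      rw [Diagram.shuffle_pos]
      have := l.conj_le j
      simp only [Diagram.position]
      omega
    simp only [shuffleHeight, e, h3, localShift, YoungClass.height, YoungClass.col_mk]
    ring

theorem shuffleHeight_one : shuffleHeight (Shuffle.one n m) 0 =
    (YoungClass.mk (Diagram.empty n m) 0).height := by
  funext a
  have hpos (i : Fin n) : (Shuffle.one n m).pos (Sum.inl i) = i.val := rfl
  have hpos' (j : Fin m) : (Shuffle.one n m).pos (Sum.inr j) = n + j.val := by
    change ((Fin.natAdd n j).val : ℤ) = _
    simp
  rcases a with i | j
  · have e : (localPerm n m 0).symm (Sum.inl i) = Sum.inl i := rfl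
    have h : (i.val : ℤ) / n = 0 := Int.ediv_eq_zero_of_lt (by omega) (by omega)
    simp [shuffleHeight, e, hpos, localShift, YoungClass.height, YoungClass.row_mk, rowLevel,
      Diagram.empty, h]
  · have e : (localPerm n m 0).symm (Sum.inr j) = Sum.inr j := rfl
    simp [shuffleHeight, e, hpos', localShift, YoungClass.height, YoungClass.col_mk,
      Diagram.empty, Diagram.conj]

namespace YoungClass

theorem isAffineOrder_height (v : YoungClass n m) : IsAffineOrder v.height := by
  obtain ⟨l, k, rfl⟩ := v.exists_mk
  exact (isAffineOrder_shuffleHeight l.shuffle k).of_sub_eq k (shuffleHeight_shuffle l k)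

/-- Both sums equal `|λ| + m k`. Multiplication by `n` trades the wrap counts for the values of the
rotation, which merely permutes the indices. -/
theorem sum_row_eq_sum_col (v : YoungClass n m) : ∑ i, v.row i = ∑ j, v.col j := by
  obtain ⟨l, k, rfl⟩ := v.exists_mk
  have hn : (n : ℤ) ≠ 0 := by have := NeZero.ne n; omega
  apply mul_left_cancel₀ hn
  have h1 : ∑ i : Fin n, (((finRotate n ^ k) i).val : ℤ) = ∑ i : Fin n, (i.val : ℤ) :=
    Equiv.sum_comp (finRotate n ^ k) fun i : Fin n => (i.val : ℤ)
  have h2 : ∑ i : Fin n, (l.part ((finRotate n ^ k) i).rev : ℤ) = ∑ i, (l.part i : ℤ) :=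
    Equiv.sum_comp ((finRotate n ^ k).trans Fin.revPerm) fun i : Fin n => (l.part i : ℤ)
  have h3 : ∑ i, (l.part i : ℤ) = ∑ j, (l.conj j : ℤ) := by
    exact_mod_cast l.sum_part_eq_sum_conj
  have h4 (i : Fin n) : (n : ℤ) * (mk l k).row i = n * l.part ((finRotate n ^ k) i).rev +
      (m * i.val + m * k - m * ((finRotate n ^ k) i).val) := by
    have := val_finRotate_zpow_add k i
    simp only [row_mk, rowLevel]
    linear_combination (m : ℤ) * this
  rw [Finset.mul_sum]
  simp only [h4, Finset.sum_add_distrib, Finset.sum_sub_distrib, ← Finset.mul_sum, h1, h2, h3,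
    col_mk, Finset.sum_const, Finset.card_univ, Fintype.card_fin, nsmul_eq_mul]
  ring

/-- A common change `c` of all positions raises every row level by `c` and lowers every column level
by `c`. Equality of the two sums of levels gives `(n + m) c = 0`. -/
theorem height_sub_eq_sub (hm : 0 < m) {v w : YoungClass n m}
    (h : ∀ a b, v.height b - v.height a = w.height b - w.height a) : v = w := by
  set c := w.row 0 - v.row 0 with hc
  have hrow (i : Fin n) : w.row i = v.row i + c := by
    have := h (Sum.inl 0) (Sum.inl i)
    simp only [height] at this
    linarith
  have hcol (j : Fin m) : w.col j = v.col j - c := by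
    have := h (Sum.inl 0) (Sum.inr j)
    simp only [height] at this
    linarith
  have hsum := w.sum_row_eq_sum_col
  simp only [hrow, hcol, Finset.sum_add_distrib, Finset.sum_sub_distrib, v.sum_row_eq_sum_col,
    Finset.sum_const, Finset.card_univ, Fintype.card_fin, nsmul_eq_mul] at hsum
  have h0 : ((n : ℤ) + m) * c = 0 := by linarith
  have hc0 : c = 0 := by
    rcases mul_eq_zero.1 h0 with h | h
    · omega
    · exact h
  exact col_injective hm (funext fun j => by rw [hcol, hc0, sub_zero])

theorem AddArrow.isHeightReflection (hN : 2 ≤ n + m) {i : Fin n} {j : Fin m}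
    {v w : YoungClass n m} (h : AddArrow i j v w) :
    ∃ p, IsHeightReflection v.height w.height (Sum.inl i) (Sum.inr j) p := by
  obtain ⟨Q, h1, h2⟩ := h.isCorner
  -- The period `Q` of the corner is the coefficient of `δ̄` in the reflected root.
  refine ⟨Q, isHeightReflection_of_swap v.isAffineOrder_height w.isAffineOrder_height hN (by simp)
    ?_ ?_ ?_ ?_⟩
  · simp only [affHeight, height, h1, h2]
    ring
  · simp only [height, h.row_eq.1]
    ring
  · simp only [height, h.col_eq.1]
    ring
  · rintro (i' | j') hi hj
    · simp only [height]
      rw [h.row_eq.2 i' fun e => hi (by rw [e])]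
    · simp only [height]
      rw [h.col_eq.2 j' fun e => hj (by rw [e])]

end YoungClass

end YoungHeight

/-! ### Odd reflections and the map from classes of diagrams to Borel subalgebras -/

noncomputable section BorelAction

variable {k : Type*} [Field k] {n m : ℕ}

theorem exists_affRoot_of_isoRoot (k : Type*) [Field k] (α : IsoRoot n m) :
    ∃ a b : Idx n m, a ≠ b ∧ ∀ p : ℤ,
      (α.sign : ℤ) • (eps (Sum.inl α.row) - eps (Sum.inr α.col)) + p • deltaBar k n m =
        affRoot k a b p := by
  rcases Int.units_eq_one_or α.sign with hs | hs
  · exact ⟨Sum.inl α.row, Sum.inr α.col, by simp, fun p => by simp [hs, affRoot]⟩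
  · exact ⟨Sum.inr α.col, Sum.inl α.row, by simp, fun p => by simp [hs, affRoot]⟩

variable [NeZero n] [CharZero k]

theorem AffineBorel.exists_height (b : AffineBorel k n m) :
    ∃ f, IsAffineOrder f ∧ b.1 = heightBorel k f := by
  obtain ⟨_, σ, r, rfl⟩ := b
  exact ⟨_, isAffineOrder_shuffleHeight σ r, extendedBorel_eq_heightBorel σ r⟩

/-- The reflected root has height one, and among the translates of `α` by multiples of `δ̄` at most
one has this height. The positive roots after the reflection are then prescribed. -/
theorem isActionRel_borelArrow (hN : 2 ≤ n + m) :
    IsActionRel (BorelArrow : IsoRoot n m → AffineBorel k n m → AffineBorel k n m → Prop) where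
  unique {α b b₁ b₂} h₁ h₂ := by
    obtain ⟨f, hf, hb⟩ := b.exists_height
    obtain ⟨f₁, hf₁, hb₁⟩ := b₁.exists_height
    obtain ⟨f₂, hf₂, hb₂⟩ := b₂.exists_height
    obtain ⟨x, y, hxy, hroot⟩ := exists_affRoot_of_isoRoot k α
    obtain ⟨p, h₁⟩ := h₁
    obtain ⟨q, h₂⟩ := h₂
    rw [hroot, hb, hb₁, isReflection_heightBorel_iff _ _ hxy] at h₁
    rw [hroot, hb, hb₂, isReflection_heightBorel_iff _ _ hxy] at h₂
    have e₁ := h₁.height_eq_one hf hf₁ hN hxy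
    have e₂ := h₂.height_eq_one hf hf₂ hN hxy
    have hpq : p = q := by
      have hN' : (n : ℤ) + m ≠ 0 := by omega
      apply mul_right_cancel₀ hN'
      simp only [affHeight] at e₁ e₂
      linarith
    subst hpq
    apply Subtype.ext
    rw [hb₁, hb₂]
    exact heightBorel_eq_of_le_iff fun c d q hcd => (h₁.2 c d q hcd).trans (h₂.2 c d q hcd).symm
  symm {α b b'} h := by
    obtain ⟨f, hf, hb⟩ := b.exists_height
    obtain ⟨g, hg, hb'⟩ := b'.exists_height
    obtain ⟨x, y, hxy, hroot⟩ := exists_affRoot_of_isoRoot k α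
    obtain ⟨p, h⟩ := h
    rw [hroot, hb, hb', isReflection_heightBorel_iff _ _ hxy] at h
    refine ⟨-p, ?_⟩
    have e := congrArg Neg.neg (hroot p)
    rw [neg_affRoot, neg_add, ← neg_smul, ← neg_smul] at e
    rw [IsoRoot.neg_sign, IsoRoot.neg_row, IsoRoot.neg_col, Units.val_neg, e, hb, hb',
      isReflection_heightBorel_iff _ _ hxy.symm]
    exact h.symm hf hxy

/-- The Borel subalgebra that corresponds to a class of diagrams. -/
def YoungClass.borel (k : Type*) [Field k] [CharZero k] (v : YoungClass n m) :
    AffineBorel k n m :=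
  ⟨heightBorel k v.height, by
    obtain ⟨l, r, rfl⟩ := v.exists_mk
    refine ⟨l.shuffle, r, ?_⟩
    rw [extendedBorel_eq_heightBorel]
    refine heightBorel_congr fun a b => ?_
    simp only [shuffleHeight_shuffle]
    ring⟩

namespace YoungClass

/-- The Borel subalgebra determines the positive roots, these determine the differences of heights,
and the differences determine the class. -/
theorem borel_injective (hm : 0 < m) :
    Function.Injective (borel k : YoungClass n m → AffineBorel k n m) := by
  intro v w h
  have h' : heightBorel k v.height = heightBorel k w.height := congrArg Subtype.val h
  have hn := NeZero.pos n
  have key {a b : Idx n m} (p : ℤ) (hab : a ≠ b) :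
      0 ≤ affHeight v.height a b p ↔ 0 ≤ affHeight w.height a b p := by
    rw [← rootSpace_affRoot_le_iff (k := k) _ hab, ← rootSpace_affRoot_le_iff (k := k) _ hab, h']
  exact height_sub_eq_sub hm (v.isAffineOrder_height.sub_eq_sub w.isAffineOrder_height (by omega)
    (fun a b p hab => (key p hab).1) (fun a b p hab => (key p hab).2))

theorem borelArrow_of_youngArrow (hN : 2 ≤ n + m) (α : IsoRoot n m) {v w : YoungClass n m}
    (h : YoungArrow α v w) : BorelArrow α (v.borel k) (w.borel k) := by
  have key {α : IsoRoot n m} (hs : α.sign = 1) {v w : YoungClass n m}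
      (h : AddArrow α.row α.col v w) : BorelArrow α (v.borel k) (w.borel k) := by
    obtain ⟨p, hp⟩ := h.isHeightReflection hN
    refine ⟨p, ?_⟩
    rw [hs, Units.val_one, one_smul]
    exact (isReflection_heightBorel_iff _ _ (by simp) p).2 hp
  rcases (youngArrow_iff α v w).1 h with ⟨hs, h⟩ | ⟨hs, h⟩
  · exact key hs h
  · have := (isActionRel_borelArrow hN).symm (key (α := -α) (by simp [hs]) h)
    rwa [IsoRoot.neg_neg'] at this

/-- A reflected root has height one, so the positions of row and column are adjacent up to the
period, which produces a corner. -/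
theorem exists_youngArrow_of_borelArrow (hN : 2 ≤ n + m) (α : IsoRoot n m) {v : YoungClass n m}
    {b : AffineBorel k n m} (h : BorelArrow α (v.borel k) b) : ∃ w, YoungArrow α v w := by
  obtain ⟨g, hg, hb⟩ := b.exists_height
  obtain ⟨p, h⟩ := h
  simp only [youngArrow_iff]
  rw [hb] at h
  rcases Int.units_eq_one_or α.sign with hs | hs
  · have e : (1 : ℤ) • (eps (Sum.inl α.row) - eps (Sum.inr α.col)) + p • deltaBar k n m =
        affRoot k (Sum.inl α.row) (Sum.inr α.col) p := by simp [affRoot]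
    rw [hs, Units.val_one, e] at h
    have h1 := ((isReflection_heightBorel_iff _ _ (by simp) p).1 h).height_eq_one
      v.isAffineOrder_height hg hN (by simp)
    simp only [affHeight, height] at h1
    obtain ⟨w, hw⟩ := exists_addArrow_of_isCorner
      (isCorner_of_adjacent (e := 0) (i := α.row) (j := α.col) (v := v) (p := p) (Or.inl rfl)
        (by linarith))
    exact ⟨w, Or.inl ⟨hs, hw⟩⟩
  · have e : (-1 : ℤ) • (eps (Sum.inl α.row) - eps (Sum.inr α.col)) + p • deltaBar k n m =
        affRoot k (Sum.inr α.col) (Sum.inl α.row) p := by simp [affRoot]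
    rw [hs, Units.val_neg, Units.val_one, e] at h
    have h1 := ((isReflection_heightBorel_iff _ _ (by simp) p).1 h).height_eq_one
      v.isAffineOrder_height hg hN (by simp)
    simp only [affHeight, height] at h1
    obtain ⟨w, hw⟩ := exists_addArrow_of_isCorner'
      -- The root now runs from `δ_j` to `ε_i`, which reverses the sign of the period.
      (isCorner_of_adjacent (e := 1) (i := α.row) (j := α.col) (v := v) (p := -p) (Or.inr rfl)
        (by linarith))
    exact ⟨w, Or.inr ⟨hs, hw⟩⟩

theorem borel_mk_empty :
    (mk (Diagram.empty n m) 0).borel k = distinguishedBorel k n m := by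
  apply Subtype.ext
  change heightBorel k _ = extendedBorel k _ _
  rw [extendedBorel_eq_heightBorel, shuffleHeight_one]

end YoungClass

end BorelAction

theorem theorem1p1 (k : Type*) [Field k] [IsAlgClosed k] [CharZero k]
    (n m : ℕ) [NeZero n] (hnm : n ≤ m) :
    ∃ (F : IsoRoot n m ⥤ SymGroupoid (YoungClass n m))
      (B : IsoRoot n m ⥤ SymGroupoid (AffineBorel k n m)),
      HasArrows F YoungArrow ∧ HasArrows B BorelArrow ∧
      (∃ e : OrbitIso F (YoungClass.mk (Diagram.empty n m) 0) B (distinguishedBorel k n m),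
        e.toEquiv ⟨YoungClass.mk (Diagram.empty n m) 0, mem_orbit_self _ _⟩ =
          ⟨distinguishedBorel k n m, mem_orbit_self _ _⟩) ∧
      (n.Coprime m →
        ∃ e : OrbitIso F (YoungClass.mk (Diagram.empty n m) 0) (SV n m) (lambdaZero n m),
          (∀ q, (e.toEquiv q : SuperLattice n m) = xMap n m q) ∧
          e.toEquiv ⟨YoungClass.mk (Diagram.empty n m) 0, mem_orbit_self _ _⟩ =
            ⟨lambdaZero n m, mem_orbit_self _ _⟩) := by
  have hn := NeZero.pos n
  have hm : 0 < m := by omega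
  have hN : 2 ≤ n + m := by omega
  have hF := (YoungClass.isActionRel_youngArrow (n := n) hm).hasArrows_toFunctor
  have hB := (isActionRel_borelArrow (k := k) hN).hasArrows_toFunctor
  refine ⟨_, _, hF, hB, ?_, fun hco => ?_⟩
  · obtain ⟨e, he⟩ := exists_orbitIso (YoungClass.borel_injective (k := k) hm)
      (fun α v w h => (hB α _ _).2
        (YoungClass.borelArrow_of_youngArrow hN α ((hF α v w).1 h)))
      (fun α v y h => by
        obtain ⟨w, hw⟩ := YoungClass.exists_youngArrow_of_borelArrow hN α ((hB α _ _).1 h)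
        exact ⟨w, (hF α v w).2 hw⟩)
      YoungClass.borel_mk_empty
    exact ⟨e, Subtype.ext ((he _).trans YoungClass.borel_mk_empty)⟩
  · obtain ⟨e, he⟩ := exists_orbitIso (G' := SV n m) (YoungClass.xMap_injective hm)
      (fun α v w h => hasArrow_SV_of_youngArrow α ((hF α v w).1 h))
      (fun α v y h => by
        obtain ⟨w, hw⟩ := exists_youngArrow_of_hasArrow_SV hco α h
        exact ⟨w, (hF α v w).2 hw⟩)
      xMap_mk_empty
    exact ⟨e, he, Subtype.ext ((he _).trans xMap_mk_empty)⟩
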